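/- **Definitions.** For an integer polynomial $P$ let $H(P)$ be the maximum modulus of its coefficients. For an algebraic number $\alpha$ let $H(\alpha)=H(P_\alpha)$, where $P_\alpha$ is its minimal polynomial over $\mathbb{Z}$ with coprime coefficients. An algebraic unit is a nonzero $\alpha$ such that both $\alpha$ and $\alpha^{-1}$ are algebraic integers. Let $\xi$ be a real number. All suprema below are taken in $[-\infty,\infty]$, with $\sup\emptyset=-\infty$. Consider the system $$H(P)\le X,\qquad 0<|P(\xi)|\le X^{-w}. \tag{1}$$ * For $d\ge 0$, $\widehat w_d(\xi)$ is the supremum of the real $w$ such that for all sufficiently large real $X$ the system (1) has a solution in integer polynomials $P$ of degree at most $d$. * For $d\ge 1$, $w^{u}_{=d}(\xi)$ is the supremum of the real $w$ such that there are infinitely many irreducible monic $P\in\mathbb{Z}[T]$ of degree exactly $d$ with constant coefficient $\pm1$ that satisfy (1) for some real $X$. * For $d\ge 1$, $w^{*u}_{=d}(\xi)$ is the supremum of the real $w$ such that $0<|\xi-\alpha|\le H(\alpha)^{-w-1}$ holds for infinitely many real algebraic units $\alpha$ of degree exactly $d$. **Theorem.** Let $m,n$ be integers with $1\le m\le n$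 and $n\ge 2$, and let $\xi$ be a transcendental real number. Assume $$\min\{w^{u}_{=m}(\xi),\ \widehat w_{n-2}(\xi)\}>2n-7 .$$ Then $$w^{u}_{=n}(\xi)\ \ge\ \min\{w^{u}_{=m}(\xi),\ \widehat w_{n-2}(\xi)\}$$ and $$w^{*u}_{=n}(\xi)\ \ge\ \tfrac32\min\{w^{u}_{=m}(\xi),\ \widehat w_{n-2}(\xi)\}-n+\tfrac12 .$$ In particular, under the same assumption, $$w^{u}_{=n}(\xi)\ \ge\ \min\{w^{u}_{=n-1}(\xi),\ n-2\}.$$ -/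

import Mathlib

open Polynomial

namespace ExactDegree

/-- The system `H(P) ≤ X`, `0 < |P(ξ)| ≤ X ^ (-w)` for an integer polynomial `P`, where
`H(P) = P.supNorm` is the naive height, the maximum modulus of the coefficients of `P`. -/
def SmallAt (ξ w X : ℝ) (P : ℤ[X]) : Prop :=
  P.supNorm ≤ X ∧ 0 < |aeval ξ P| ∧ |aeval ξ P| ≤ X ^ (-w)

/-- The supremum of a set of real numbers in `[-∞, ∞]`; it is `-∞` for the empty set. -/
noncomputable def supExp (S : Set ℝ) : EReal :=
  ⨆ w ∈ S, (w : EReal)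

/-- The classical uniform exponent `ŵ_d(ξ)`: the supremum of `w` such that for all large `X`
the system has a solution in integer polynomials of degree at most `d`. -/
noncomputable def uniformExp (d : ℕ) (ξ : ℝ) : EReal :=
  supExp {w | ∃ X₀ : ℝ, ∀ X : ℝ, X₀ ≤ X → ∃ P : ℤ[X], P.natDegree ≤ d ∧ SmallAt ξ w X P}

/-- Irreducible monic integer polynomials of degree exactly `d` with constant coefficient `±1`. -/
def IsUnitPoly (d : ℕ) (P : ℤ[X]) : Prop :=
  Irreducible P ∧ P.Monic ∧ P.natDegree = d ∧ (P.coeff 0 = 1 ∨ P.coeff 0 = -1)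

/-- The exponent `w^u_{=d}(ξ)`: the supremum of `w` such that the system has infinitely many
solutions in irreducible monic integer polynomials `P` of degree exactly `d` with constant
coefficient `±1`. -/
noncomputable def unitPolyExp (d : ℕ) (ξ : ℝ) : EReal :=
  supExp {w | {P : ℤ[X] | IsUnitPoly d P ∧ ∃ X : ℝ, SmallAt ξ w X P}.Infinite}

/-- Real algebraic units: nonzero `α` such that `α` and `α⁻¹` are algebraic integers. -/
def IsAlgUnit (α : ℝ) : Prop :=
  α ≠ 0 ∧ IsIntegral ℤ α ∧ IsIntegral ℤ α⁻¹

/-- The exponent `w^{*u}_{=d}(ξ)`: the supremum of `w` such that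
`0 < |ξ - α| ≤ H(α) ^ (-w - 1)` has infinitely many solutions in real algebraic units `α` of
degree exactly `d`. Here `H(α)` is the naive height of the minimal polynomial of `α` over `ℤ`
with coprime coefficients; as `α` is an algebraic integer, this is the monic `minpoly ℤ α`. -/
noncomputable def unitRootExp (d : ℕ) (ξ : ℝ) : EReal :=
  supExp {w | {α : ℝ | IsAlgUnit α ∧ (minpoly ℚ α).natDegree = d ∧
    0 < |ξ - α| ∧ |ξ - α| ≤ (minpoly ℤ α).supNorm ^ (-w - 1)}.Infinite}

end ExactDegree

/-! Let w lie below the minimum. Take a unit polynomial Q of degree m and large height Y, small at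
ξ, and P of degree at most n - 2 and height at most κY, also small. Put S = Q (X - 1)^(n - m) and
strip P of its factors X - 1. For small κ the Mahler measure of P is too small for Q to divide it,
so S and P are coprime. Every R_c = S + c X P is monic of degree n with constant coefficient ±1, and
for bounded c it has height O(Y) and size O(Y^(-w)) at ξ.

Only boundedly many R_c are reducible (`exists_irreducible_of_card_lt`). The weight |A(ξ)| M(A)^v is
multiplicative, so a reducible R_c has an irreducible factor that is linear, or small at ξ and of
degree at most n - 2. With too many reducible R_c, two of these factors, A ≠ B, agree in degree,
constant coefficient and approximate Mahler measure. Then (A - B)/X is an integer polynomial of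
degree at most n - 4, and its resultant with A is a nonzero integer. If Z bounds the Mahler measures
and ε the values at ξ, that resultant is O(ε Z^(2n - 7)), which is less than 1
(`exists_const_one_le_of_ne`). This is the source of 2n - 7.

For roots with w > n - 2, a third order bound for Res(S, P) shows that S'(ξ) and P'(ξ) are not both
small. Hence at most one R_c has a small derivative at ξ, and an irreducible R_c among the others
has a real root close to ξ (`exists_root_near`). If w ≤ n - 2, the assumption leaves n ≤ 4, where
explicit trinomials and quartics suffice. The last claim uses Dirichlet's theorem for n = 3, 4. -/

namespace ExactDegree

open Filter

/-! ### Determinant bounds for Sylvester matrices -/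

/-- The row offset of a column of the Sylvester matrix. -/
def sylvesterShift (m n : ℕ) (j : Fin (m + n)) : ℕ :=
  j.addCases (fun j₁ ↦ (j₁ : ℕ)) (fun j₁ ↦ (j₁ : ℕ))

lemma sylvester_apply_cases {R : Type*} [Semiring R] (f g : R[X]) (m n : ℕ) (i j : Fin (m + n)) :
    sylvester f g m n i j = 0 ∨ (sylvesterShift m n j ≤ i ∧
      (sylvester f g m n i j = f.coeff (i - sylvesterShift m n j) ∨
        sylvester f g m n i j = g.coeff (i - sylvesterShift m n j))) := by
  induction j using Fin.addCases with
  | left j =>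
    simp only [sylvester, sylvesterShift, Matrix.of_apply, Fin.addCases_left]
    split_ifs with h
    · exact Or.inr ⟨h.1, Or.inr rfl⟩
    · exact Or.inl rfl
  | right j =>
    simp only [sylvester, sylvesterShift, Matrix.of_apply, Fin.addCases_right]
    split_ifs with h
    · exact Or.inr ⟨h.1, Or.inl rfl⟩
    · exact Or.inl rfl

/-- Only the first column of each block is unshifted, so three rows cannot all be matched with
unshifted columns. -/
lemma sylvesterShift_eq_zero {m n : ℕ} {j : Fin (m + n)} (h : sylvesterShift m n j = 0) :
    (j : ℕ) = 0 ∨ (j : ℕ) = m := by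
  induction j using Fin.addCases with
  | left j => left; simpa [sylvesterShift] using h
  | right j => right; simpa [sylvesterShift] using h

lemma abs_det_le_of_forall_perm {N : ℕ} (A : Matrix (Fin N) (Fin N) ℝ) (b : ℝ)
    (h : ∀ σ : Equiv.Perm (Fin N), ∏ i, |A i (σ i)| ≤ b) : |A.det| ≤ N.factorial * b := by
  rw [← Matrix.det_transpose, Matrix.det_apply']
  refine (Finset.abs_sum_le_sum_abs _ _).trans ?_
  calc _ ≤ ∑ σ : Equiv.Perm (Fin N), b := by
        refine Finset.sum_le_sum fun σ _ ↦ ?_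
        rw [abs_mul, Finset.abs_prod]
        rcases Int.units_eq_one_or (Equiv.Perm.sign σ) with hs | hs <;> simpa [hs] using h σ
    _ = _ := by simp [Fintype.card_perm]

lemma prod_abs_le_pow_card {ι : Type*} (s : Finset ι) {f : ι → ℝ} {B : ℝ} (h : ∀ i, |f i| ≤ B) :
    ∏ i ∈ s, |f i| ≤ B ^ s.card :=
  (Finset.prod_le_prod (fun _ _ ↦ abs_nonneg _) fun i _ ↦ h i).trans_eq (Finset.prod_const B)

/-- First order bound for a resultant of polynomials with small constant coefficients. -/
lemma abs_resultant_le {f g : ℝ[X]} {m n : ℕ} (hmn : 0 < m + n) {B ε : ℝ} (hε : 0 ≤ ε)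
    (hf : ∀ i, |f.coeff i| ≤ B) (hg : ∀ i, |g.coeff i| ≤ B)
    (hf0 : |f.coeff 0| ≤ ε) (hg0 : |g.coeff 0| ≤ ε) :
    |resultant f g m n| ≤ (m + n).factorial * (ε * B ^ (m + n - 1)) := by
  have hB : 0 ≤ B := (abs_nonneg _).trans (hf 0)
  refine abs_det_le_of_forall_perm _ _ fun σ ↦ ?_
  obtain ⟨k, hk⟩ : ∃ k, m + n = k + 1 := ⟨m + n - 1, by omega⟩
  have entry : ∀ i j, |sylvester f g m n i j| ≤ B := fun i j ↦ by
    rcases sylvester_apply_cases f g m n i j with h | ⟨-, h | h⟩ <;> rw [h]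
    · simpa using hB
    · exact hf _
    · exact hg _
  -- Row 0 holds only constant coefficients and zeros, so each Leibniz product has a factor at most
  -- ε.
  have entry0 : ∀ j, |sylvester f g m n ⟨0, hmn⟩ j| ≤ ε := fun j ↦ by
    rcases sylvester_apply_cases f g m n ⟨0, hmn⟩ j with h | ⟨-, h | h⟩ <;> rw [h]
    · simpa using hε
    · simpa using hf0
    · simpa using hg0
  rw [← Finset.mul_prod_erase _ _ (Finset.mem_univ (⟨0, hmn⟩ : Fin (m + n)))]
  refine mul_le_mul (entry0 _) ?_ (Finset.prod_nonneg fun _ _ ↦ abs_nonneg _) hε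
  refine (prod_abs_le_pow_card _ fun i ↦ entry i (σ i)).trans_eq ?_
  simp

/-- Third order bound for a resultant of polynomials whose constant coefficients are at most `ε`
and whose linear coefficients are at most `D`. -/
lemma abs_resultant_le_of_linear {f g : ℝ[X]} {m n : ℕ} (hmn : 3 ≤ m + n) {B D ε : ℝ} (hε : 0 ≤ ε)
    (hεD : ε ≤ D)
    (hf : ∀ i, |f.coeff i| ≤ B) (hg : ∀ i, |g.coeff i| ≤ B)
    (hf0 : |f.coeff 0| ≤ ε) (hg0 : |g.coeff 0| ≤ ε)
    (hf1 : |f.coeff 1| ≤ D) (hg1 : |g.coeff 1| ≤ D) :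
    |resultant f g m n| ≤
      (m + n).factorial * ((ε * D ^ 2 + ε ^ 2 * B) * B ^ (m + n - 3)) := by
  have hD : 0 ≤ D := hε.trans hεD
  have hB : 0 ≤ B := (abs_nonneg _).trans (hf 0)
  refine abs_det_le_of_forall_perm _ _ fun σ ↦ ?_
  have entry : ∀ i j, |sylvester f g m n i j| ≤ B := fun i j ↦ by
    rcases sylvester_apply_cases f g m n i j with h | ⟨-, h | h⟩ <;> rw [h]
    · simpa using hB
    · exact hf _
    · exact hg _
  have entry0 : ∀ i j : Fin (m + n), (i : ℕ) ≤ sylvesterShift m n j → |sylvester f g m n i j| ≤ ε :=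
    fun i j hij ↦ by
      rcases sylvester_apply_cases f g m n i j with h | ⟨-, h | h⟩ <;> rw [h]
      · simpa using hε
      · simpa [Nat.sub_eq_zero_of_le hij] using hf0
      · simpa [Nat.sub_eq_zero_of_le hij] using hg0
  have entry1 : ∀ i j : Fin (m + n), (i : ℕ) ≤ sylvesterShift m n j + 1 → |sylvester f g m n i j| ≤ D :=
    fun i j hij ↦ by
      rcases hij.lt_or_eq with h' | h'
      · exact (entry0 i j (by omega)).trans hεD
      rcases sylvester_apply_cases f g m n i j with h | ⟨-, h | h⟩ <;> rw [h]
      · simpa using hD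
      · simpa [h'] using hf1
      · simpa [h'] using hg1
  let i₀ : Fin (m + n) := ⟨0, by omega⟩
  let i₁ : Fin (m + n) := ⟨1, by omega⟩
  let i₂ : Fin (m + n) := ⟨2, by omega⟩
  have h01 : i₁ ≠ i₀ := by simp [i₀, i₁]
  have h02 : i₂ ≠ i₀ := by simp [i₀, i₂]
  have h12 : i₂ ≠ i₁ := by simp [i₁, i₂]
  have m1 : i₁ ∈ (Finset.univ : Finset (Fin (m + n))).erase i₀ := by simp [h01]
  have m2 : i₂ ∈ ((Finset.univ : Finset (Fin (m + n))).erase i₀).erase i₁ := by simp [h02, h12]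
  rw [← Finset.mul_prod_erase _ _ (Finset.mem_univ i₀), ← Finset.mul_prod_erase _ _ m1,
    ← Finset.mul_prod_erase _ _ m2]
  have hrest : ∏ x ∈ ((Finset.univ.erase i₀).erase i₁).erase i₂, |sylvester f g m n x (σ x)| ≤
      B ^ (m + n - 3) := by
    refine (prod_abs_le_pow_card _ fun i ↦ entry i (σ i)).trans_eq ?_
    rw [Finset.card_erase_of_mem m2, Finset.card_erase_of_mem m1,
      Finset.card_erase_of_mem (Finset.mem_univ _)]
    simp only [Finset.card_univ, Fintype.card_fin]
    rfl
  have hrest0 : 0 ≤ ∏ x ∈ ((Finset.univ.erase i₀).erase i₁).erase i₂,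
      |sylvester f g m n x (σ x)| := Finset.prod_nonneg fun _ _ ↦ abs_nonneg _
  have key : |sylvester f g m n i₀ (σ i₀)| *
      (|sylvester f g m n i₁ (σ i₁)| * |sylvester f g m n i₂ (σ i₂)|) ≤
      ε * D ^ 2 + ε ^ 2 * B := by
    have e0 := entry0 i₀ (σ i₀) (by simp [i₀])
    have n0 := abs_nonneg (sylvester f g m n i₀ (σ i₀))
    have n1 := abs_nonneg (sylvester f g m n i₁ (σ i₁))
    have n2 := abs_nonneg (sylvester f g m n i₂ (σ i₂))
    -- Rows 0, 1, 2 meet at least one shifted column. Its entry is 0 in row 0, at most ε in row 1,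
    -- and at most D in row 2. The products are accordingly 0, at most ε² B, or at most ε D².
    by_cases hs1 : sylvesterShift m n (σ i₁) = 0
    · by_cases hs2 : sylvesterShift m n (σ i₂) = 0
      · have hs0 : sylvesterShift m n (σ i₀) ≠ 0 := fun hs0 ↦ by
          have d01 : (σ i₁ : ℕ) ≠ σ i₀ := fun h ↦ h01 (σ.injective (Fin.ext h))
          have d02 : (σ i₂ : ℕ) ≠ σ i₀ := fun h ↦ h02 (σ.injective (Fin.ext h))
          have d12 : (σ i₂ : ℕ) ≠ σ i₁ := fun h ↦ h12 (σ.injective (Fin.ext h))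
          have := sylvesterShift_eq_zero hs0
          have := sylvesterShift_eq_zero hs1
          have := sylvesterShift_eq_zero hs2
          omega
        have z : sylvester f g m n i₀ (σ i₀) = 0 := by
          rcases sylvester_apply_cases f g m n i₀ (σ i₀) with h | ⟨h, -⟩
          · exact h
          · exact absurd (Nat.le_zero.mp h) hs0
        rw [z, abs_zero, zero_mul]
        positivity
      · have e1 := entry1 i₁ (σ i₁) (by simp [i₁])
        have e2 := entry1 i₂ (σ i₂) (show 2 ≤ sylvesterShift m n (σ i₂) + 1 by omega)
        calc _ ≤ ε * (D * D) := mul_le_mul e0 (mul_le_mul e1 e2 n2 hD) (by positivity) hε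
          _ ≤ _ := by nlinarith [mul_nonneg (sq_nonneg ε) hB]
    · have e1 := entry0 i₁ (σ i₁) (show 1 ≤ sylvesterShift m n (σ i₁) by omega)
      have e2 := entry i₂ (σ i₂)
      calc _ ≤ ε * (ε * B) := mul_le_mul e0 (mul_le_mul e1 e2 n2 hε) (by positivity) hε
        _ ≤ _ := by nlinarith [mul_nonneg hε (sq_nonneg D)]
  calc _ = (|sylvester f g m n i₀ (σ i₀)| *
      (|sylvester f g m n i₁ (σ i₁)| * |sylvester f g m n i₂ (σ i₂)|)) *
        ∏ x ∈ ((Finset.univ.erase i₀).erase i₁).erase i₂, |sylvester f g m n x (σ x)| := by ring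
    _ ≤ _ := mul_le_mul key hrest hrest0 (by positivity)

/-! ### Integer polynomials at a real point -/

lemma norm_coeff_le_supNorm (P : ℤ[X]) (i : ℕ) : |(P.coeff i : ℝ)| ≤ P.supNorm := by
  have := P.le_supNorm i
  rwa [Int.norm_eq_abs] at this

lemma supNorm_le_of_forall {P : ℤ[X]} {B : ℝ} (h : ∀ i, |(P.coeff i : ℝ)| ≤ B) : P.supNorm ≤ B := by
  obtain ⟨i, hi⟩ := P.exists_eq_supNorm
  rw [hi, Int.norm_eq_abs]
  exact h i

lemma one_le_supNorm {P : ℤ[X]} (hP : P ≠ 0) : 1 ≤ P.supNorm := by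
  refine le_trans ?_ (norm_coeff_le_supNorm P P.natDegree)
  have : P.coeff P.natDegree ≠ 0 := by simpa using hP
  exact_mod_cast Int.one_le_abs this

lemma aeval_eq_eval_map (P : ℤ[X]) (x : ℝ) : aeval x P = (P.map (Int.castRingHom ℝ)).eval x := by
  rw [eval_map, aeval_def]; rfl

lemma aeval_ne_zero_of_transcendental {ξ : ℝ} (hξ : Transcendental ℚ ξ) {P : ℤ[X]} (hP : P ≠ 0) :
    aeval ξ P ≠ 0 := fun h ↦
  hξ ((IsFractionRing.isAlgebraic_iff ℤ ℚ ℝ).mp ⟨P, hP, h⟩)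

/-- A crude constant bounding Taylor coefficients at `x` in terms of the height. -/
noncomputable def taylorConst (n : ℕ) (x : ℝ) : ℝ := (n + 1) * (1 + |x|) ^ n

lemma one_le_taylorConst (n : ℕ) (x : ℝ) : 1 ≤ taylorConst n x := by
  have h1 : (1 : ℝ) ≤ (1 + |x|) ^ n := one_le_pow₀ (by linarith [abs_nonneg x])
  have h2 : (1 : ℝ) ≤ n + 1 := by linarith [Nat.cast_nonneg (α := ℝ) n]
  simpa [taylorConst] using one_le_mul_of_one_le_of_one_le h2 h1

lemma abs_taylor_coeff_le {P : ℤ[X]} {n : ℕ} (hP : P.natDegree ≤ n) (x : ℝ) (i : ℕ) :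
    |(taylor x (P.map (Int.castRingHom ℝ))).coeff i| ≤ taylorConst n x * P.supNorm := by
  have hH := P.supNorm_nonneg
  have key : (taylor x (P.map (Int.castRingHom ℝ))).coeff i =
      ∑ k ∈ Finset.range (n + 1), (P.coeff k : ℝ) * (x ^ (k - i) * (k.choose i : ℝ)) := by
    rw [taylor_apply, comp, eval₂_eq_sum_range' C
      ((natDegree_map_le.trans hP).trans_lt n.lt_succ_self), finsetSum_coeff]
    refine Finset.sum_congr rfl fun k _ ↦ ?_
    rw [coeff_C_mul, coeff_X_add_C_pow]
    simp
  rw [key]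
  refine (Finset.abs_sum_le_sum_abs _ _).trans ?_
  calc _ ≤ ∑ k ∈ Finset.range (n + 1), P.supNorm * (1 + |x|) ^ n := by
        refine Finset.sum_le_sum fun k hk ↦ ?_
        have hx : 1 ≤ 1 + |x| := by linarith [abs_nonneg x]
        rw [abs_mul]
        refine mul_le_mul (norm_coeff_le_supNorm P k) ?_ (abs_nonneg _) hH
        refine le_trans ?_ (pow_le_pow_right₀ hx (Nat.lt_succ_iff.mp (Finset.mem_range.mp hk)))
        rw [abs_mul, abs_pow, Nat.abs_cast]
        rcases le_or_gt i k with hik | hik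
        -- The quantity to bound is a single term of the binomial expansion of (1 + |x|)^k.
        · rw [add_pow]
          refine le_trans (le_of_eq ?_) (Finset.single_le_sum
            (f := fun m ↦ (1 : ℝ) ^ m * |x| ^ (k - m) * (k.choose m : ℝ))
            (fun _ _ ↦ by positivity) (Finset.mem_range.mpr (Nat.lt_succ_iff.mpr hik)))
          simp
        · rw [Nat.choose_eq_zero_of_lt hik]
          simp only [Nat.cast_zero, mul_zero]
          positivity
    _ = _ := by
        rw [Finset.sum_const, Finset.card_range, nsmul_eq_mul, taylorConst]; push_cast; ring

/-- The resultant is invariant under translation of the variable, so the Taylor shifts at x still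
have a nonzero integer resultant, while their low coefficients are now the values and derivatives at
x. -/
lemma one_le_abs_resultant {P Q : ℤ[X]} (h : resultant P Q ≠ 0) (x : ℝ) :
    1 ≤ |resultant (taylor x (P.map (Int.castRingHom ℝ))) (taylor x (Q.map (Int.castRingHom ℝ)))
      P.natDegree Q.natDegree| := by
  have hinj : Function.Injective (Int.castRingHom ℝ) := Int.cast_injective
  have hP : P.natDegree = (taylor x (P.map (Int.castRingHom ℝ))).natDegree := by
    rw [natDegree_taylor, natDegree_map_eq_of_injective hinj]
  have hQ : Q.natDegree = (taylor x (Q.map (Int.castRingHom ℝ))).natDegree := by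
    rw [natDegree_taylor, natDegree_map_eq_of_injective hinj]
  rw [hP, hQ, resultant_taylor, natDegree_map_eq_of_injective hinj,
    natDegree_map_eq_of_injective hinj, resultant_map_map, eq_intCast, ← Int.cast_abs]
  exact_mod_cast Int.one_le_abs h

lemma abs_taylor_coeff_zero (P : ℤ[X]) (x : ℝ) :
    |(taylor x (P.map (Int.castRingHom ℝ))).coeff 0| = |aeval x P| := by
  rw [taylor_coeff_zero, aeval_eq_eval_map]

lemma abs_taylor_coeff_one (P : ℤ[X]) (x : ℝ) :
    |(taylor x (P.map (Int.castRingHom ℝ))).coeff 1| = |aeval x (derivative P)| := by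
  rw [taylor_coeff_one, aeval_eq_eval_map, derivative_map]

/-- Two integer polynomials with nonzero resultant cannot both be very small at a point. -/
lemma one_le_of_resultant_ne_zero {P Q : ℤ[X]} (h : resultant P Q ≠ 0) {n : ℕ}
    (hP : P.natDegree ≤ n) (hQ : Q.natDegree ≤ n) (hPQ : 0 < P.natDegree + Q.natDegree)
    {x Y ε : ℝ} (hPY : P.supNorm ≤ Y) (hQY : Q.supNorm ≤ Y)
    (hPε : |aeval x P| ≤ ε) (hQε : |aeval x Q| ≤ ε) :
    1 ≤ (P.natDegree + Q.natDegree).factorial *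
      (ε * (taylorConst n x * Y) ^ (P.natDegree + Q.natDegree - 1)) := by
  have hT := zero_le_one.trans (one_le_taylorConst n x)
  refine (one_le_abs_resultant h x).trans (abs_resultant_le hPQ ((abs_nonneg _).trans hPε)
    (fun i ↦ (abs_taylor_coeff_le hP x i).trans (by gcongr))
    (fun i ↦ (abs_taylor_coeff_le hQ x i).trans (by gcongr)) ?_ ?_)
  · rwa [abs_taylor_coeff_zero]
  · rwa [abs_taylor_coeff_zero]

/-- Two integer polynomials with nonzero resultant which are both small at a point cannot both have
a very small derivative there. -/
lemma one_le_of_resultant_ne_zero_of_derivative {P Q : ℤ[X]} (h : resultant P Q ≠ 0) {n : ℕ}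
    (hP : P.natDegree ≤ n) (hQ : Q.natDegree ≤ n) (hPQ : 3 ≤ P.natDegree + Q.natDegree)
    {x Y D ε : ℝ} (hPY : P.supNorm ≤ Y) (hQY : Q.supNorm ≤ Y)
    (hεD : ε ≤ D)
    (hPε : |aeval x P| ≤ ε) (hQε : |aeval x Q| ≤ ε)
    (hPD : |aeval x (derivative P)| ≤ D) (hQD : |aeval x (derivative Q)| ≤ D) :
    1 ≤ (P.natDegree + Q.natDegree).factorial *
      ((ε * D ^ 2 + ε ^ 2 * (taylorConst n x * Y)) *
        (taylorConst n x * Y) ^ (P.natDegree + Q.natDegree - 3)) := by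
  have hT := zero_le_one.trans (one_le_taylorConst n x)
  refine (one_le_abs_resultant h x).trans (abs_resultant_le_of_linear hPQ
    ((abs_nonneg _).trans hPε) hεD
    (fun i ↦ (abs_taylor_coeff_le hP x i).trans (by gcongr))
    (fun i ↦ (abs_taylor_coeff_le hQ x i).trans (by gcongr)) ?_ ?_ ?_ ?_)
  · rwa [abs_taylor_coeff_zero]
  · rwa [abs_taylor_coeff_zero]
  · rwa [abs_taylor_coeff_one]
  · rwa [abs_taylor_coeff_one]

/-! ### The Mahler measure of an integer polynomial -/

/-- The Mahler measure of an integer polynomial. -/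
noncomputable def mahler (P : ℤ[X]) : ℝ := (P.map (Int.castRingHom ℂ)).mahlerMeasure

lemma mahler_mul (P Q : ℤ[X]) : mahler (P * Q) = mahler P * mahler Q := by
  rw [mahler, Polynomial.map_mul, mahlerMeasure_mul, mahler, mahler]

lemma one_le_mahler {P : ℤ[X]} (hP : P ≠ 0) : 1 ≤ mahler P :=
  one_le_mahlerMeasure_of_ne_zero hP

/-- Factors X - 1 cost nothing: they pad Q up to degree n and can be stripped from P. -/
lemma mahler_X_sub_one_pow (k : ℕ) : mahler ((X - 1) ^ k) = 1 := by
  induction k with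
  | zero => simp [mahler]
  | succ k ih =>
    have h : (X - 1 : ℂ[X]) = X - C 1 := by simp
    rw [pow_succ, mahler_mul, ih, mahler, Polynomial.map_sub, map_X, Polynomial.map_one, h,
      mahlerMeasure_X_sub_C]
    simp

lemma natDegree_map_complex (P : ℤ[X]) : (P.map (Int.castRingHom ℂ)).natDegree = P.natDegree :=
  natDegree_map_eq_of_injective Int.cast_injective P

/-- In bounded degree the Mahler measure is comparable to the height, and unlike the height it is
exactly multiplicative. -/
lemma supNorm_le_mahler {P : ℤ[X]} {n : ℕ} (hP : P.natDegree ≤ n) :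
    P.supNorm ≤ 2 ^ n * mahler P := by
  refine supNorm_le_of_forall fun i ↦ ?_
  have h := norm_coeff_le_choose_mul_mahlerMeasure i (P.map (Int.castRingHom ℂ))
  rw [natDegree_map_complex, coeff_map, eq_intCast, Complex.norm_intCast] at h
  refine h.trans (mul_le_mul_of_nonneg_right ?_ (mahlerMeasure_nonneg _))
  have h1 : (P.natDegree.choose i : ℝ) ≤ 2 ^ P.natDegree := by
    exact_mod_cast Nat.choose_le_two_pow P.natDegree i
  exact h1.trans (pow_le_pow_right₀ one_le_two hP)

lemma mahler_le_supNorm {P : ℤ[X]} {n : ℕ} (hP : P.natDegree ≤ n) :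
    mahler P ≤ (n + 1) * P.supNorm := by
  refine (mahlerMeasure_le_sum_norm_coeff _).trans ?_
  rw [sum_over_range' _ (by simp) (n + 1) (by rw [natDegree_map_complex]; omega)]
  calc _ ≤ ∑ _k ∈ Finset.range (n + 1), P.supNorm := Finset.sum_le_sum fun k _ ↦ by
        rw [coeff_map, eq_intCast, Complex.norm_intCast]
        exact norm_coeff_le_supNorm P k
    _ = _ := by simp

/-! ### Asymptotic comparison of powers -/

lemma eventually_const_mul_rpow_lt (K : ℝ) {p q : ℝ} (hpq : p < q) :
    ∀ᶠ Y : ℝ in atTop, K * Y ^ p < Y ^ q := by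
  filter_upwards [(tendsto_rpow_atTop (sub_pos.mpr hpq)).eventually_gt_atTop K,
    eventually_gt_atTop 0] with Y h hY
  have h1 : Y ^ q = Y ^ (q - p) * Y ^ p := by rw [← Real.rpow_add hY]; congr 1; ring
  rw [h1]
  exact mul_lt_mul_of_pos_right h (Real.rpow_pos_of_pos hY p)

/-! ### Factors of unit polynomials -/

/-- Both |A(ξ)| M(A)^w and η^(deg A) are multiplicative in A, so one factor of any factorization
inherits the inequality; descend to an irreducible one. -/
lemma exists_irreducible_factor_small {ξ w η : ℝ} (hη : 0 ≤ η) (hη1 : η ≤ 1)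
    {P : ℤ[X]} (hP : P.Monic) (hdeg : 0 < P.natDegree)
    (hsmall : |aeval ξ P| * mahler P ^ w < η ^ P.natDegree) :
    ∃ A : ℤ[X], A.Monic ∧ Irreducible A ∧ A ∣ P ∧ |aeval ξ A| * mahler A ^ w < η := by
  induction hd : P.natDegree using Nat.strong_induction_on generalizing P with
  | _ d ih =>
    by_cases hirr : Irreducible P
    · refine ⟨P, hP, hirr, dvd_rfl, hsmall.trans_le ?_⟩
      exact pow_le_of_le_one hη hη1 hdeg.ne'
    · have hP1 : P ≠ 1 := by rintro rfl; simp at hdeg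
      rw [hP.irreducible_iff_natDegree'] at hirr
      push Not at hirr
      obtain ⟨A, B, hA, hB, rfl, hBd⟩ := hirr hP1
      rw [Finset.mem_Ioc] at hBd
      have hAB : (A * B).natDegree = A.natDegree + B.natDegree := hA.natDegree_mul hB
      have hMA := one_le_mahler hA.ne_zero
      have hMB := one_le_mahler hB.ne_zero
      have hsplit : |aeval ξ (A * B)| * mahler (A * B) ^ w =
          (|aeval ξ A| * mahler A ^ w) * (|aeval ξ B| * mahler B ^ w) := by
        rw [map_mul, abs_mul, mahler_mul, Real.mul_rpow (by linarith) (by linarith)]; ring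
      by_cases h : |aeval ξ A| * mahler A ^ w < η ^ A.natDegree
      · obtain ⟨F, h1, h2, h3, h4⟩ := ih A.natDegree (by omega) hA (by omega) h rfl
        exact ⟨F, h1, h2, h3.mul_right B, h4⟩
      · have h' : |aeval ξ B| * mahler B ^ w < η ^ B.natDegree := by
          by_contra h'
          rw [hsplit, hAB, pow_add] at hsmall
          exact absurd (mul_le_mul (not_lt.mp h) (not_lt.mp h') (by positivity)
            (by positivity)) (not_le.mpr hsmall)
        obtain ⟨F, h1, h2, h3, h4⟩ := ih B.natDegree (by omega) hB (by omega) h' rfl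
        exact ⟨F, h1, h2, h3.mul_left A, h4⟩

/-- Write P = A B with A the small factor. Either deg B ≥ 2, which lowers the degree of A enough for
the resultant estimate, or B is linear and can be chosen instead. -/
lemma exists_factor_of_not_irreducible {ξ w η : ℝ} (hη : 0 ≤ η) (hη1 : η ≤ 1)
    {P : ℤ[X]} (hP : P.Monic) (hdeg : 0 < P.natDegree) (hirr : ¬ Irreducible P)
    (hsmall : |aeval ξ P| * mahler P ^ w < η ^ P.natDegree) :
    ∃ A : ℤ[X], A.Monic ∧ Irreducible A ∧ A ∣ P ∧ (A.natDegree = 1 ∨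
      A.natDegree + 2 ≤ P.natDegree ∧ |aeval ξ A| * mahler A ^ w < η) := by
  obtain ⟨A, hA, hAi, ⟨B, rfl⟩, hAs⟩ := exists_irreducible_factor_small hη hη1 hP hdeg hsmall
  have hB : B.Monic := hA.of_mul_monic_left hP
  have hAB : (A * B).natDegree = A.natDegree + B.natDegree := hA.natDegree_mul hB
  by_cases hB2 : 2 ≤ B.natDegree
  · exact ⟨A, hA, hAi, dvd_mul_right A B, Or.inr ⟨by omega, hAs⟩⟩
  · have hB1 : B.natDegree = 1 := by
      have : B.natDegree ≠ 0 := fun h0 ↦ by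
        rw [hB.natDegree_eq_zero] at h0
        rw [h0, mul_one] at hirr
        exact hirr hAi
      omega
    refine ⟨B, hB, ?_, dvd_mul_left B A, Or.inl hB1⟩
    exact (hB.irreducible_iff_irreducible_map_fraction_map (K := ℚ)).mpr
      (irreducible_of_degree_eq_one (by
        rw [hB.degree_map, degree_eq_natDegree hB.ne_zero, hB1]; rfl))

lemma resultant_ne_zero_of_isCoprime_map {P Q : ℤ[X]}
    (h : IsCoprime (P.map (Int.castRingHom ℚ)) (Q.map (Int.castRingHom ℚ))) :
    resultant P Q ≠ 0 := fun h0 ↦ by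
  have h1 : resultant (P.map (Int.castRingHom ℚ)) (Q.map (Int.castRingHom ℚ)) ≠ 0 := fun h2 ↦
    (resultant_eq_zero_iff.mp h2).2 h
  rw [natDegree_map_eq_of_injective Int.cast_injective,
    natDegree_map_eq_of_injective Int.cast_injective, resultant_map_map, h0] at h1
  simp at h1

lemma isCoprime_map_of_irreducible {A P : ℤ[X]} (hA : A.Monic) (hAi : Irreducible A)
    (h : ¬ A ∣ P) : IsCoprime (A.map (Int.castRingHom ℚ)) (P.map (Int.castRingHom ℚ)) := by
  have h1 : Irreducible (A.map (Int.castRingHom ℚ)) :=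
    (hA.irreducible_iff_irreducible_map_fraction_map (K := ℚ)).mp hAi
  rw [h1.coprime_iff_not_dvd]
  rwa [map_dvd_map _ Int.cast_injective hA]

/-- Two different irreducible monic polynomials of the same degree and with the same constant
coefficient cannot both be small at a transcendental point: subtract them and divide by `X`. -/
lemma exists_const_one_le_of_ne (n : ℕ) {ξ : ℝ} (hξ : ξ ≠ 0) :
    ∃ K : ℝ, 0 ≤ K ∧ ∀ A B : ℤ[X], A.Monic → Irreducible A → B.Monic → A ≠ B →
      A.natDegree = B.natDegree → A.natDegree + 2 ≤ n → A.coeff 0 = B.coeff 0 →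
      ∀ Z ε w : ℝ, 1 ≤ Z → mahler A ≤ Z → mahler B ≤ Z → |aeval ξ A| ≤ ε → |aeval ξ B| ≤ ε →
      2 * (n : ℝ) - 7 ≤ w → 1 ≤ K * (ε * Z ^ w) := by
  set T := taylorConst n ξ with hT
  have hT1 : 1 ≤ T := one_le_taylorConst n ξ
  refine ⟨(2 * n).factorial * ((1 + 2 / |ξ|) * (T * (2 * 2 ^ n)) ^ (2 * n)), by positivity, ?_⟩
  intro A B hA hAi hB hne hdeg han h0 Z ε w hZ hAZ hBZ hAε hBε hw
  have hε : 0 ≤ ε := (abs_nonneg _).trans hAε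
  have hξ0 : 0 < |ξ| := abs_pos.mpr hξ
  have hD0 : A - B ≠ 0 := sub_ne_zero.mpr hne
  -- Equal leading coefficients lower the degree of A - B, and equal constant coefficients allow
  -- division by X: in total deg P ≤ deg A - 2.
  obtain ⟨P, hP⟩ : X ∣ A - B := X_dvd_iff.mpr (by simp [h0])
  have hP0 : P ≠ 0 := by rintro rfl; simp at hP; exact hD0 hP
  have hdegP : (A - B).natDegree = P.natDegree + 1 := by
    rw [hP, natDegree_X_mul hP0]
  have hlt : (A - B).natDegree < A.natDegree := by
    refine natDegree_lt_natDegree hD0 (degree_sub_lt_left ?_ hA.ne_zero (by rw [hA, hB]))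
    rw [degree_eq_natDegree hA.ne_zero, degree_eq_natDegree hB.ne_zero, hdeg]
  have hres : resultant A P ≠ 0 := resultant_ne_zero_of_isCoprime_map
    (isCoprime_map_of_irreducible hA hAi fun hdvd ↦ by
      have := natDegree_le_of_dvd hdvd hP0
      omega)
  have hAH : A.supNorm ≤ 2 ^ n * Z :=
    (supNorm_le_mahler (n := n) (by omega)).trans (by gcongr)
  have hBH : B.supNorm ≤ 2 ^ n * Z :=
    (supNorm_le_mahler (n := n) (by omega)).trans (by gcongr)
  have hPH : P.supNorm ≤ 2 * 2 ^ n * Z := by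
    refine supNorm_le_of_forall fun i ↦ ?_
    have hc : P.coeff i = A.coeff (i + 1) - B.coeff (i + 1) := by
      rw [← coeff_sub, hP, coeff_X_mul]
    rw [hc]
    push_cast
    refine (abs_sub _ _).trans ?_
    linarith [norm_coeff_le_supNorm A (i + 1), norm_coeff_le_supNorm B (i + 1)]
  have hPε : |aeval ξ P| ≤ ε * (1 + 2 / |ξ|) := by
    have h1 : ξ * aeval ξ P = aeval ξ A - aeval ξ B := by
      rw [← map_sub, hP, map_mul, aeval_X]
    have h2 : |ξ| * |aeval ξ P| ≤ 2 * ε := by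
      rw [← abs_mul, h1]
      exact (abs_sub _ _).trans (by linarith)
    have h3 : |aeval ξ P| ≤ 2 * ε / |ξ| := by
      rw [le_div_iff₀ hξ0]; linarith
    calc _ ≤ 2 * ε / |ξ| := h3
      _ ≤ ε + 2 * ε / |ξ| := by linarith
      _ = _ := by ring
  have hAε' : |aeval ξ A| ≤ ε * (1 + 2 / |ξ|) :=
    hAε.trans (le_mul_of_one_le_right hε (by linarith [div_pos two_pos hξ0]))
  have key := one_le_of_resultant_ne_zero hres (n := n) (x := ξ) (Y := 2 * 2 ^ n * Z)
    (by omega) (by omega) (by omega)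
    (hAH.trans (by nlinarith [pow_pos (two_pos (α := ℝ)) n])) hPH hAε' hPε
  refine key.trans ?_
  set N := A.natDegree + P.natDegree with hN
  -- The degrees are at most n - 2 and n - 4, so the power N - 1 in the resultant bound is at most
  -- 2n - 7.
  have hNn : N + 6 ≤ 2 * n := by omega
  have hZw : Z ^ (N - 1) ≤ Z ^ w := by
    rw [← Real.rpow_natCast]
    refine Real.rpow_le_rpow_of_exponent_le hZ (le_trans ?_ hw)
    rw [Nat.cast_sub (by omega)]
    have : (N : ℝ) + 6 ≤ 2 * n := by exact_mod_cast hNn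
    push_cast; linarith
  have hfac : (N.factorial : ℝ) ≤ (2 * n).factorial := by
    exact_mod_cast Nat.factorial_le (by omega)
  have h1 : (1 : ℝ) ≤ T * (2 * 2 ^ n) := by
    have : (1 : ℝ) ≤ 2 ^ n := one_le_pow₀ one_le_two
    nlinarith
  have hpow : (T * (2 * 2 ^ n * Z)) ^ (N - 1) ≤ (T * (2 * 2 ^ n)) ^ (2 * n) * Z ^ w := by
    rw [← mul_assoc, mul_pow]
    exact mul_le_mul (pow_le_pow_right₀ h1 (by omega)) hZw (by positivity) (by positivity)
  calc _ ≤ ((2 * n).factorial : ℝ) *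
        (ε * (1 + 2 / |ξ|) * ((T * (2 * 2 ^ n)) ^ (2 * n) * Z ^ w)) := by gcongr
    _ = _ := by ring

/-! ### Irreducible members of a linear pencil of unit polynomials -/

lemma natDegree_add_C_mul {S G : ℤ[X]} (hdeg : G.natDegree < S.natDegree) (c : ℤ) :
    (S + C c * G).natDegree = S.natDegree :=
  natDegree_add_eq_left_of_natDegree_lt ((natDegree_C_mul_le c G).trans_lt hdeg)

lemma monic_add_C_mul {S G : ℤ[X]} (hS : S.Monic) (hdeg : G.natDegree < S.natDegree) (c : ℤ) :
    (S + C c * G).Monic := by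
  refine hS.add_of_left ?_
  have h0 : S ≠ 0 := hS.ne_zero
  rw [degree_eq_natDegree h0]
  refine (degree_le_natDegree).trans_lt ?_
  exact_mod_cast (natDegree_C_mul_le c G).trans_lt hdeg

lemma coeff_zero_isUnit_of_dvd {A P : ℤ[X]} (h : A ∣ P) (hP : P.coeff 0 = 1 ∨ P.coeff 0 = -1) :
    A.coeff 0 = 1 ∨ A.coeff 0 = -1 := by
  obtain ⟨B, rfl⟩ := h
  rw [mul_coeff_zero] at hP
  rw [← Int.isUnit_iff] at hP ⊢
  exact isUnit_of_mul_isUnit_left hP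

lemma natDegree_pos_of_irreducible {A : ℤ[X]} (hA : A.Monic) (hAi : Irreducible A) :
    0 < A.natDegree := by
  rw [Nat.pos_iff_ne_zero]
  intro h
  rw [hA.natDegree_eq_zero] at h
  exact hAi.not_isUnit (h ▸ isUnit_one)

/-- A common irreducible factor of two members of the pencil `S + c G` divides `S` and `G`. -/
lemma dvd_of_dvd_pencil {S G A : ℤ[X]} (hA : A.Monic) (hAi : Irreducible A) {c d : ℤ} (hcd : c ≠ d)
    (hc : A ∣ S + C c * G) (hd : A ∣ S + C d * G) : A ∣ S ∧ A ∣ G := by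
  have h1 : A ∣ C (c - d) * G := by
    have := dvd_sub hc hd
    rwa [show S + C c * G - (S + C d * G) = C (c - d) * G by rw [C_sub]; ring] at this
  have hG : A ∣ G := by
    refine (hAi.prime.dvd_or_dvd h1).resolve_left fun h ↦ ?_
    have h2 := natDegree_le_of_dvd h (C_ne_zero.mpr (sub_ne_zero.mpr hcd))
    rw [natDegree_C] at h2
    have := natDegree_pos_of_irreducible hA hAi
    omega
  exact ⟨(dvd_add_left (hG.mul_left _)).mp hc, hG⟩

/-- In a pencil `S + c G` of unit polynomials without common factor, all of whose members are
small at `ξ` with exponent more than `2n - 7`, only boundedly many members are reducible. -/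
theorem exists_irreducible_of_card_lt {n : ℕ} (hn : 1 ≤ n) {ξ w v : ℝ} (hξ : ξ ≠ 0)
    (hv : 0 ≤ v) (hnv : 2 * (n : ℝ) - 7 ≤ v) (hvw : v < w) :
    ∃ C₀ : ℕ, ∀ K₁ K₂ : ℝ, 0 ≤ K₁ → 0 ≤ K₂ → ∀ᶠ Y : ℝ in atTop, ∀ S G : ℤ[X],
      S.Monic → S.natDegree = n → (S.coeff 0 = 1 ∨ S.coeff 0 = -1) →
      G.coeff 0 = 0 → G.natDegree < n →
      (∀ A : ℤ[X], A.Monic → Irreducible A → A ∣ S → ¬ A ∣ G) →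
      ∀ T : Finset ℤ, C₀ < T.card →
      (∀ c ∈ T, (S + C c * G).supNorm ≤ K₁ * Y ∧ |aeval ξ (S + C c * G)| ≤ K₂ * Y ^ (-w)) →
      ∃ c ∈ T, Irreducible (S + C c * G) := by
  have hn0 : (0 : ℝ) < n := by exact_mod_cast hn
  -- Half of the gain w - v, shared among n degrees.
  set τ := (w - v) / (2 * n) with hτ
  have hτ0 : 0 < τ := div_pos (by linarith) (by linarith)
  have hτn : n * τ < w - v := by
    rw [hτ, mul_div_assoc', div_lt_iff₀ (by linarith)]
    nlinarith
  -- The logarithmic bin width: Mahler measures in one bin differ by at most Y^δ, and the resulting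
  -- loss Y^(δ v) stays below Y^τ.
  set δ := τ / (2 * (v + 1)) with hδ
  have hδ0 : 0 < δ := div_pos hτ0 (by linarith)
  have hδv : δ * v < τ := by
    rw [hδ, div_mul_eq_mul_div, div_lt_iff₀ (by linarith)]
    nlinarith
  obtain ⟨K, hK0, hK⟩ := exists_const_one_le_of_ne n hξ
  -- Classes by degree, constant coefficient and position of log M(A) in [0, 2 log Y]; the 2 absorbs
  -- the factor (n + 1) K₁ for large Y. Their number is independent of K₁, K₂ and Y.
  let box : Finset (ℕ × ℤ × ℕ) :=
    Finset.range (n + 1) ×ˢ ({1, -1} : Finset ℤ) ×ˢ Finset.range (⌊2 / δ⌋₊ + 1)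
  refine ⟨box.card, fun K₁ K₂ hK₁ hK₂ ↦ ?_⟩
  filter_upwards [eventually_gt_atTop 1,
    eventually_const_mul_rpow_lt (K₂ * ((n + 1) * K₁) ^ v) (p := -w + v) (q := -τ * n)
      (by linarith),
    eventually_const_mul_rpow_lt ((n + 1) * K₁) (p := 1) (q := 2) (by norm_num),
    eventually_const_mul_rpow_lt K (p := -τ + δ * v) (q := 0) (by linarith)] with Y hY hE1 hE2 hE3
  intro S G hS hSn hS0 hG0 hGn hcop T hT hR
  have hY0 : 0 < Y := by linarith
  have hlogY : 0 < Real.log Y := Real.log_pos hY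
  rw [Real.rpow_one] at hE2
  by_contra! hirr
  have hRdeg : ∀ c, (S + C c * G).natDegree = n := fun c ↦ by
    rw [natDegree_add_C_mul (by omega), hSn]
  have hRmon : ∀ c, (S + C c * G).Monic := fun c ↦ monic_add_C_mul hS (by omega) c
  have hRM : ∀ c ∈ T, mahler (S + C c * G) ≤ (n + 1) * K₁ * Y := fun c hc ↦
    calc _ ≤ (n + 1) * (S + C c * G).supNorm := mahler_le_supNorm (hRdeg c).le
      _ ≤ (n + 1) * (K₁ * Y) := by gcongr; exact (hR c hc).1
      _ = _ := by ring
  have hfac : ∀ c ∈ T, ∃ A : ℤ[X], A.Monic ∧ Irreducible A ∧ A ∣ S + C c * G ∧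
      (A.natDegree = 1 ∨ A.natDegree + 2 ≤ n ∧ |aeval ξ A| * mahler A ^ v < Y ^ (-τ)) := by
    intro c hc
    have hsmall : |aeval ξ (S + C c * G)| * mahler (S + C c * G) ^ v <
        (Y ^ (-τ)) ^ (S + C c * G).natDegree := by
      rw [hRdeg, ← Real.rpow_mul_natCast hY0.le]
      refine lt_of_le_of_lt ?_ hE1
      have hM0 : 0 ≤ mahler (S + C c * G) := mahlerMeasure_nonneg _
      calc _ ≤ K₂ * Y ^ (-w) * ((n + 1) * K₁ * Y) ^ v := by
            gcongr
            · exact (hR c hc).2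
            · exact hRM c hc
        _ = _ := by
            rw [Real.mul_rpow (by positivity) hY0.le, Real.rpow_add hY0]; ring
    have := exists_factor_of_not_irreducible (Real.rpow_nonneg hY0.le _)
      (Real.rpow_le_one_of_one_le_of_nonpos hY.le (by linarith)) (hRmon c)
      (by rw [hRdeg]; exact hn) (hirr c hc) hsmall
    rwa [hRdeg] at this
  choose! A hA hAi hAR hAs using hfac
  have hM1 : ∀ c ∈ T, 1 ≤ mahler (A c) := fun c hc ↦ one_le_mahler (hA c hc).ne_zero
  have hM2 : ∀ c ∈ T, mahler (A c) ≤ Y ^ (2 : ℝ) := fun c hc ↦ by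
    obtain ⟨B, hB⟩ := hAR c hc
    have hB0 : B ≠ 0 := by
      rintro rfl
      exact (hRmon c).ne_zero (by rw [hB, mul_zero])
    have h1 : mahler (A c) ≤ mahler (S + C c * G) := by
      rw [hB, mahler_mul]
      exact le_mul_of_one_le_right (by linarith [hM1 c hc]) (one_le_mahler hB0)
    exact h1.trans ((hRM c hc).trans hE2.le)
  let k : ℤ → ℕ := fun c ↦ ⌊Real.log (mahler (A c)) / (δ * Real.log Y)⌋₊
  have hmaps : ∀ c ∈ T, ((A c).natDegree, (A c).coeff 0, k c) ∈ box := by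
    intro c hc
    simp only [box, Finset.mem_product, Finset.mem_range, Finset.mem_insert,
      Finset.mem_singleton, Nat.lt_succ_iff]
    refine ⟨?_, coeff_zero_isUnit_of_dvd (hAR c hc) ?_, Nat.floor_le_floor ?_⟩
    · have := natDegree_le_of_dvd (hAR c hc) (hRmon c).ne_zero
      rwa [hRdeg] at this
    · simpa [hG0] using hS0
    · rw [div_le_div_iff₀ (by positivity) hδ0]
      have := Real.log_le_log (by linarith [hM1 c hc]) (hM2 c hc)
      rw [Real.log_rpow hY0] at this
      nlinarith
  obtain ⟨c, hc, d, hd, hcd, hcl⟩ := Finset.exists_ne_map_eq_of_card_lt_of_maps_to hT hmaps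
  simp only [Prod.mk.injEq] at hcl
  obtain ⟨hdegcd, h0cd, hkcd⟩ := hcl
  have hne : A c ≠ A d := fun h ↦ by
    have := dvd_of_dvd_pencil (hA c hc) (hAi c hc) hcd (hAR c hc) (h ▸ hAR d hd)
    exact hcop _ (hA c hc) (hAi c hc) this.1 this.2
  -- Monic linear polynomials with the same constant coefficient coincide.
  have hdeg1 : (A c).natDegree ≠ 1 := fun h ↦ hne <| by
    rw [(hA c hc).eq_X_add_C h, (hA d hd).eq_X_add_C (hdegcd ▸ h), h0cd]
  obtain ⟨hcn, hcs⟩ := (hAs c hc).resolve_left hdeg1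
  obtain ⟨-, hds⟩ := (hAs d hd).resolve_left (hdegcd ▸ hdeg1)
  have hMk : ∀ e ∈ T, Y ^ (δ * k e) ≤ mahler (A e) ∧ mahler (A e) ≤ Y ^ (δ * (k e + 1)) := by
    intro e he
    have hpos : 0 < mahler (A e) := by linarith [hM1 e he]
    have hlog : 0 ≤ Real.log (mahler (A e)) := Real.log_nonneg (hM1 e he)
    have h1 := Nat.floor_le (a := Real.log (mahler (A e)) / (δ * Real.log Y)) (by positivity)
    have h2 := (Nat.lt_floor_add_one (Real.log (mahler (A e)) / (δ * Real.log Y))).le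
    rw [le_div_iff₀ (by positivity)] at h1
    rw [div_le_iff₀ (by positivity)] at h2
    constructor
    · rw [← Real.log_le_log_iff (Real.rpow_pos_of_pos hY0 _) hpos, Real.log_rpow hY0]
      linarith
    · rw [← Real.log_le_log_iff hpos (Real.rpow_pos_of_pos hY0 _), Real.log_rpow hY0]
      linarith
  have hval : ∀ e ∈ T, |aeval ξ (A e)| * mahler (A e) ^ v < Y ^ (-τ) →
      |aeval ξ (A e)| ≤ Y ^ (-τ - δ * k e * v) := by
    intro e he hes
    have h1 : (Y ^ (δ * k e)) ^ v ≤ mahler (A e) ^ v :=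
      Real.rpow_le_rpow (Real.rpow_nonneg hY0.le _) (hMk e he).1 hv
    rw [← Real.rpow_mul hY0.le] at h1
    rw [Real.rpow_sub hY0, le_div_iff₀ (Real.rpow_pos_of_pos hY0 _)]
    exact (mul_le_mul_of_nonneg_left h1 (abs_nonneg _)).trans hes.le
  have hkd : k d = k c := hkcd.symm
  have key := hK (A c) (A d) (hA c hc) (hAi c hc) (hA d hd) hne hdegcd hcn h0cd
    (Y ^ (δ * (k c + 1))) (Y ^ (-τ - δ * k c * v)) v
    (Real.one_le_rpow hY.le (by positivity)) (hMk c hc).2 (hkd ▸ (hMk d hd).2)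
    (hval c hc hcs) (hkd ▸ hval d hd hds) hnv
  rw [← Real.rpow_mul hY0.le, ← Real.rpow_add hY0,
    show -τ - δ * k c * v + δ * (k c + 1) * v = -τ + δ * v by ring] at key
  rw [Real.rpow_zero] at hE3
  linarith

/-! ### The pencil attached to a good unit polynomial and a good uniform approximation -/

lemma infinite_of_forall_exists_lt {α : Type*} {s : Set α} (f : α → ℝ) (hpos : ∀ x ∈ s, 0 < f x)
    (h : ∀ ε > 0, ∃ x ∈ s, f x < ε) : s.Infinite := fun hfin ↦ by
  obtain ⟨x₀, hx₀, -⟩ := h 1 one_pos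
  obtain ⟨x, hx, hmin⟩ := Set.exists_min_image s f hfin ⟨x₀, hx₀⟩
  obtain ⟨y, hy, hyx⟩ := h (f x) (hpos x hx)
  exact absurd (hmin y hy) (not_le.mpr hyx)

/-- Northcott's theorem: bounded degree and Mahler measure leave finitely many integer polynomials.
-/
lemma exists_supNorm_gt {s : Set ℤ[X]} (hs : s.Infinite) {m : ℕ} (hm : ∀ P ∈ s, P.natDegree ≤ m)
    (B : ℝ) : ∃ P ∈ s, B < P.supNorm := by
  by_contra! h
  refine hs ((finite_mahlerMeasure_le m (((m + 1) * B).toNNReal)).subset fun P hP ↦ ⟨hm P hP, ?_⟩)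
  refine le_trans ?_ (Real.le_coe_toNNReal _)
  exact (mahler_le_supNorm (hm P hP)).trans (by gcongr; exact h P hP)

lemma irreducible_X_sub_one : Irreducible (X - 1 : ℤ[X]) := by
  simpa using (prime_X_sub_C (1 : ℤ)).irreducible

/-- For arbitrarily large `Y` there are a unit polynomial `S` of degree `n` and a coprime
polynomial `P` of degree at most `n - 2`, of height `O(Y)` and of size `O(Y ^ (-w))` at `ξ`. -/
lemma exists_coprime_pair {m n : ℕ} (hm : 1 ≤ m) (hmn : m ≤ n) {ξ w : ℝ}
    (hξ : Transcendental ℚ ξ) (hw : 0 ≤ w)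
    (hu : {P : ℤ[X] | IsUnitPoly m P ∧ ∃ X : ℝ, SmallAt ξ w X P}.Infinite)
    (hv : ∃ X₀ : ℝ, ∀ X : ℝ, X₀ ≤ X → ∃ P : ℤ[X], P.natDegree ≤ n - 2 ∧ SmallAt ξ w X P) :
    ∃ K : ℝ, 0 ≤ K ∧ ∃ᶠ Y : ℝ in atTop, ∃ S P : ℤ[X], S.Monic ∧ S.natDegree = n ∧
      (S.coeff 0 = 1 ∨ S.coeff 0 = -1) ∧ P ≠ 0 ∧ P.natDegree ≤ n - 2 ∧
      IsCoprime (S.map (Int.castRingHom ℚ)) (P.map (Int.castRingHom ℚ)) ∧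
      S.supNorm ≤ K * Y ∧ P.supNorm ≤ K * Y ∧
      |aeval ξ S| ≤ K * Y ^ (-w) ∧ |aeval ξ P| ≤ K * Y ^ (-w) := by
  obtain ⟨X₀, hX₀⟩ := hv
  -- Chosen to give 2^n M(P) ≤ Y/2, whereas 2^n M(Q) ≥ Y, so that Q cannot divide P.
  obtain ⟨κ, hκ⟩ : ∃ κ : ℝ, κ = 1 / (2 ^ (n + 1) * (n + 1)) := ⟨_, rfl⟩
  have hκ0 : 0 < κ := by rw [hκ]; positivity
  have hκ1 : 2 ^ n * ((n + 1) * κ) = 1 / 2 := by rw [hκ]; field_simp; ring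
  have hξ1 : 0 < |ξ - 1| := by
    have := aeval_ne_zero_of_transcendental hξ irreducible_X_sub_one.ne_zero
    simpa using this
  obtain ⟨K, hK⟩ : ∃ K : ℝ,
      K = 2 ^ n * (n + 1) + 1 + (1 + |ξ - 1|) ^ n + (1 + 1 / |ξ - 1|) ^ n * κ ^ (-w) := ⟨_, rfl⟩
  have a1 : (0 : ℝ) ≤ 2 ^ n * (n + 1) := by positivity
  have a2 : (0 : ℝ) ≤ (1 + |ξ - 1|) ^ n := by positivity
  have a3 : (0 : ℝ) ≤ (1 + 1 / |ξ - 1|) ^ n * κ ^ (-w) := by positivity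
  refine ⟨K, by linarith, frequently_atTop.mpr fun Y₀ ↦ ?_⟩
  obtain ⟨Q, ⟨⟨hQi, hQm, hQd, hQ0⟩, X₁, hQX, hQpos, hQs⟩, hQY⟩ :=
    exists_supNorm_gt hu (m := m) (fun P hP ↦ hP.1.2.2.1.le) (max Y₀ (max 1 (X₀ / κ)))
  set Y := Q.supNorm with hY
  rw [max_lt_iff, max_lt_iff, div_lt_iff₀ hκ0] at hQY
  obtain ⟨hY₀, hY1, hYX⟩ := hQY
  have hYpos : 0 < Y := by linarith
  obtain ⟨P, hPd, hPX, hPpos, hPs⟩ := hX₀ (κ * Y) (by linarith)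
  have hP0 : P ≠ 0 := by rintro rfl; simp at hPpos
  have hMP : 2 ^ n * mahler P ≤ Y / 2 :=
    calc 2 ^ n * mahler P ≤ 2 ^ n * ((n + 1) * (κ * Y)) := by
          gcongr
          exact (mahler_le_supNorm (n := n) (by omega)).trans (by gcongr)
      _ = (2 ^ n * ((n + 1) * κ)) * Y := by ring
      _ = _ := by rw [hκ1]; ring
  -- S may contain powers of X - 1, so these leave P. The value at ξ changes by a bounded factor
  -- because ξ ≠ 1.
  obtain ⟨P₁, hP₁, hP₁d⟩ := exists_eq_pow_rootMultiplicity_mul_and_not_dvd P hP0 1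
  set e := rootMultiplicity 1 P
  have hP₁0 : P₁ ≠ 0 := by rintro rfl; exact hP₁d (dvd_zero _)
  rw [C_1] at hP₁ hP₁d
  have hX1 : (X - 1 : ℤ[X]).Monic := by simpa using monic_X_sub_C (1 : ℤ)
  have hX1d : (X - 1 : ℤ[X]).natDegree = 1 := by simpa using natDegree_X_sub_C (1 : ℤ)
  have hdegP : P.natDegree = e + P₁.natDegree := by
    rw [hP₁, (hX1.pow e).natDegree_mul' hP₁0, hX1.natDegree_pow, hX1d, mul_one]
  have hMP₁ : mahler P = mahler P₁ := by
    rw [hP₁, mahler_mul, mahler_X_sub_one_pow, one_mul]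
  have hQP : ¬ Q ∣ P₁ := fun ⟨V, hV⟩ ↦ by
    have hV0 : V ≠ 0 := by rintro rfl; exact hP₁0 (by rw [hV, mul_zero])
    have h1 : mahler Q ≤ mahler P := by
      rw [hMP₁, hV, mahler_mul]
      exact le_mul_of_one_le_right (mahlerMeasure_nonneg _) (one_le_mahler hV0)
    have h2 : Y ≤ 2 ^ n * mahler Q := supNorm_le_mahler (by omega)
    have h3 : 2 ^ n * mahler Q ≤ 2 ^ n * mahler P := by gcongr
    linarith
  have hYw : 0 ≤ Y ^ (-w) := by positivity
  refine ⟨Y, hY₀.le, Q * (X - 1) ^ (n - m), P₁, hQm.mul (hX1.pow _), ?_, ?_, hP₁0, by omega,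
    ?_, ?_, ?_, ?_, ?_⟩
  · rw [hQm.natDegree_mul (hX1.pow _), hX1.natDegree_pow, hX1d, hQd]; omega
  · rw [mul_coeff_zero, coeff_zero_eq_eval_zero ((X - 1) ^ (n - m))]
    rcases hQ0 with h | h <;> rcases neg_one_pow_eq_or ℤ (n - m) with h' | h' <;> simp [h, h']
  · rw [Polynomial.map_mul, Polynomial.map_pow]
    exact (isCoprime_map_of_irreducible hQm hQi hQP).mul_left
      (isCoprime_map_of_irreducible hX1 irreducible_X_sub_one hP₁d).pow_left
  · have hdeg : (Q * (X - 1) ^ (n - m)).natDegree ≤ n := by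
      rw [hQm.natDegree_mul (hX1.pow _), hX1.natDegree_pow, hX1d, hQd]; omega
    calc _ ≤ 2 ^ n * mahler Q := by
          refine (supNorm_le_mahler hdeg).trans_eq ?_
          rw [mahler_mul, mahler_X_sub_one_pow, mul_one]
      _ ≤ 2 ^ n * ((n + 1) * Y) := by gcongr; exact mahler_le_supNorm (by omega)
      _ = 2 ^ n * (n + 1) * Y := by ring
      _ ≤ K * Y := by gcongr; linarith
  · calc _ ≤ 2 ^ n * mahler P₁ := supNorm_le_mahler (by omega)
      _ ≤ Y := by rw [← hMP₁]; linarith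
      _ ≤ K * Y := le_mul_of_one_le_left hYpos.le (by linarith)
  · have h1 : |aeval ξ Q| ≤ Y ^ (-w) :=
      hQs.trans (Real.rpow_le_rpow_of_nonpos hYpos hQX (by linarith))
    have h2 : |ξ - 1| ^ (n - m) ≤ (1 + |ξ - 1|) ^ n :=
      (pow_le_pow_left₀ hξ1.le (by linarith) _).trans
        (pow_le_pow_right₀ (by linarith) (by omega))
    have h3 : aeval ξ (Q * (X - 1) ^ (n - m)) = aeval ξ Q * (ξ - 1) ^ (n - m) := by simp
    rw [h3, abs_mul, abs_pow]
    calc _ ≤ Y ^ (-w) * (1 + |ξ - 1|) ^ n := by gcongr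
      _ ≤ K * Y ^ (-w) := by rw [mul_comm]; gcongr; linarith
  · have h1 : aeval ξ P = (ξ - 1) ^ e * aeval ξ P₁ := by
      conv_lhs => rw [hP₁]
      simp
    have h2 : (1 / |ξ - 1|) ^ e ≤ (1 + 1 / |ξ - 1|) ^ n :=
      (pow_le_pow_left₀ (by positivity) (by linarith) _).trans
        (pow_le_pow_right₀ (by linarith [div_pos one_pos hξ1]) (by omega))
    have h3 : |aeval ξ P₁| = (1 / |ξ - 1|) ^ e * |aeval ξ P| := by
      rw [h1, abs_mul, abs_pow, ← mul_assoc, ← mul_pow, one_div_mul_cancel hξ1.ne', one_pow,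
        one_mul]
    rw [h3]
    calc _ ≤ (1 + 1 / |ξ - 1|) ^ n * (κ * Y) ^ (-w) := by gcongr
      _ = (1 + 1 / |ξ - 1|) ^ n * κ ^ (-w) * Y ^ (-w) := by
          rw [Real.mul_rpow hκ0.le hYpos.le]; ring
      _ ≤ K * Y ^ (-w) := by gcongr; linarith

/-- The factor X, which fixes the constant coefficient along the pencil, creates no common factor:
divisors of S have constant coefficient ±1. -/
lemma not_dvd_X_mul_of_isCoprime {S P A : ℤ[X]} (hS0 : S.coeff 0 = 1 ∨ S.coeff 0 = -1)
    (hSP : IsCoprime (S.map (Int.castRingHom ℚ)) (P.map (Int.castRingHom ℚ)))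
    (hA : A.Monic) (hAi : Irreducible A) (hAS : A ∣ S) : ¬ A ∣ X * P := fun h ↦ by
  rcases hAi.prime.dvd_or_dvd h with h | h
  · have h1 : (X : ℤ[X]) ∣ A :=
      (hAi.dvd_symm (prime_X (R := ℤ)).irreducible h)
    rw [X_dvd_iff] at h1
    have := coeff_zero_isUnit_of_dvd hAS hS0
    omega
  · have h1 := natDegree_eq_zero_of_isUnit (hSP.isUnit_of_dvd' (Polynomial.map_dvd _ hAS)
      (Polynomial.map_dvd _ h))
    rw [hA.natDegree_map] at h1
    have := natDegree_pos_of_irreducible hA hAi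
    omega

/-- The pencil `S + c X P`: its members have height `O(Y)`, are `O(Y ^ (-w))` at `ξ`, and among
any `C - 1` of its first `C` members there is an irreducible one. -/
theorem exists_pencil {m n : ℕ} (hm : 1 ≤ m) (hmn : m ≤ n) (hn : 2 ≤ n) {ξ w : ℝ}
    (hξ : Transcendental ℚ ξ) (hw : 0 < w) (hnw : 2 * (n : ℝ) - 7 < w)
    (hu : {P : ℤ[X] | IsUnitPoly m P ∧ ∃ X : ℝ, SmallAt ξ w X P}.Infinite)
    (hv : ∃ X₀ : ℝ, ∀ X : ℝ, X₀ ≤ X → ∃ P : ℤ[X], P.natDegree ≤ n - 2 ∧ SmallAt ξ w X P) :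
    ∃ (N : ℕ) (K : ℝ), 1 ≤ K ∧ ∃ᶠ Y : ℝ in atTop, ∃ S P : ℤ[X], P ≠ 0 ∧
      S.natDegree = n ∧ P.natDegree ≤ n - 2 ∧
      IsCoprime (S.map (Int.castRingHom ℚ)) (P.map (Int.castRingHom ℚ)) ∧
      S.supNorm ≤ K * Y ∧ P.supNorm ≤ K * Y ∧
      |aeval ξ S| ≤ K * Y ^ (-w) ∧ |aeval ξ P| ≤ K * Y ^ (-w) ∧
      ∀ T ⊆ Finset.Icc (1 : ℤ) N, N ≤ T.card + 1 → ∃ c ∈ T, IsUnitPoly n (S + C c * (X * P)) ∧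
        (S + C c * (X * P)).supNorm ≤ K * Y ∧ |aeval ξ (S + C c * (X * P))| ≤ K * Y ^ (-w) := by
  have hξ0 : ξ ≠ 0 := by
    have := aeval_ne_zero_of_transcendental hξ (X_ne_zero (R := ℤ))
    simpa using this
  obtain ⟨K, hK, hpair⟩ := exists_coprime_pair hm hmn hξ hw.le hu hv
  obtain ⟨C₀, hC₀⟩ := exists_irreducible_of_card_lt (n := n) (v := max 0 (2 * (n : ℝ) - 7))
    (by omega) hξ0 (le_max_left _ _) (le_max_right _ _) (max_lt hw hnw)
  -- After discarding one member, C₀ + 1 > C₀ remain.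
  set N := C₀ + 2 with hN
  obtain ⟨L, hL⟩ : ∃ L : ℝ, L = (1 + N * (1 + |ξ|)) * K + 1 := ⟨_, rfl⟩
  have hLK : K ≤ L := by
    have : 0 ≤ N * (1 + |ξ|) * K := by positivity
    linarith
  have hL1 : K * (1 + N) ≤ L := by
    have : 0 ≤ N * |ξ| * K := by positivity
    linarith
  have hL2 : K * (1 + N * |ξ|) ≤ L := by
    have : 0 ≤ N * K := by positivity
    linarith
  refine ⟨N, L, by linarith [show 0 ≤ (1 + N * (1 + |ξ|)) * K by positivity], ?_⟩
  refine (hpair.and_eventually ((hC₀ L L (by linarith) (by linarith)).and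
    (eventually_gt_atTop 0))).mono ?_
  rintro Y ⟨⟨S, P, hSm, hSn, hS0, hP0, hPn, hcop, hSH, hPH, hSs, hPs⟩, hirr, hY⟩
  have hYw : 0 ≤ Y ^ (-w) := by positivity
  have hXP : (X * P).natDegree < n := by rw [natDegree_X_mul hP0]; omega
  have hbound : ∀ c ∈ Finset.Icc (1 : ℤ) N, (S + C c * (X * P)).supNorm ≤ L * Y ∧
      |aeval ξ (S + C c * (X * P))| ≤ L * Y ^ (-w) := by
    intro c hc
    rw [Finset.mem_Icc] at hc
    have hcN : |(c : ℝ)| ≤ N := by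
      rw [abs_of_nonneg (by exact_mod_cast (by omega : (0 : ℤ) ≤ c))]
      exact_mod_cast hc.2
    constructor
    · refine supNorm_le_of_forall fun i ↦ ?_
      rw [coeff_add, coeff_C_mul]
      push_cast
      have h1 : |((X * P).coeff i : ℝ)| ≤ K * Y := by
        cases i with
        | zero => simpa using by positivity
        | succ i => rw [coeff_X_mul]; exact (norm_coeff_le_supNorm P i).trans hPH
      calc _ ≤ |(S.coeff i : ℝ)| + |(c : ℝ)| * |((X * P).coeff i : ℝ)| := by
            rw [← abs_mul]; exact abs_add_le _ _
        _ ≤ K * Y + N * (K * Y) := by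
            gcongr
            exact (norm_coeff_le_supNorm S i).trans hSH
        _ = K * (1 + N) * Y := by ring
        _ ≤ _ := by gcongr
    · have h1 : aeval ξ (S + C c * (X * P)) = aeval ξ S + c * (ξ * aeval ξ P) := by simp
      rw [h1]
      calc _ ≤ |aeval ξ S| + |(c : ℝ)| * (|ξ| * |aeval ξ P|) := by
            rw [← abs_mul, ← abs_mul]; exact abs_add_le _ _
        _ ≤ K * Y ^ (-w) + N * (|ξ| * (K * Y ^ (-w))) := by gcongr
        _ = K * (1 + N * |ξ|) * Y ^ (-w) := by ring
        _ ≤ _ := by gcongr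
  refine ⟨S, P, hP0, hSn, hPn, hcop, hSH.trans (by gcongr), hPH.trans (by gcongr),
    hSs.trans (by gcongr), hPs.trans (by gcongr), fun T hT hTN ↦ ?_⟩
  obtain ⟨c, hc, hci⟩ := hirr S (X * P) hSm hSn hS0 (by simp) hXP
    (fun A hA hAi hAS ↦ not_dvd_X_mul_of_isCoprime hS0 hcop hA hAi hAS) T (by omega)
    (fun c hc ↦ hbound c (hT hc))
  refine ⟨c, hc, ⟨hci, monic_add_C_mul hSm (by omega) c, ?_, by simpa using hS0⟩,
    hbound c (hT hc)⟩
  rw [natDegree_add_C_mul (by omega), hSn]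

/-- The exponent `w` is attained, up to an arbitrarily small loss, by unit polynomials of
degree `n`. -/
theorem infinite_unitPoly {m n : ℕ} (hm : 1 ≤ m) (hmn : m ≤ n) (hn : 2 ≤ n) {ξ w v : ℝ}
    (hξ : Transcendental ℚ ξ) (hw : 0 < w) (hnw : 2 * (n : ℝ) - 7 < w) (hvw : v < w)
    (hu : {P : ℤ[X] | IsUnitPoly m P ∧ ∃ X : ℝ, SmallAt ξ w X P}.Infinite)
    (hv : ∃ X₀ : ℝ, ∀ X : ℝ, X₀ ≤ X → ∃ P : ℤ[X], P.natDegree ≤ n - 2 ∧ SmallAt ξ w X P) :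
    {P : ℤ[X] | IsUnitPoly n P ∧ ∃ X : ℝ, SmallAt ξ v X P}.Infinite := by
  obtain ⟨N, K, hK, hpen⟩ := exists_pencil hm hmn hn hξ hw hnw hu hv
  -- The values at ξ become arbitrarily small but never vanish, so infinitely many polynomials
  -- occur.
  refine infinite_of_forall_exists_lt (fun P ↦ |aeval ξ P|)
    (fun P hP ↦ abs_pos.mpr (aeval_ne_zero_of_transcendental hξ hP.1.1.ne_zero)) fun ε hε ↦ ?_
  have hsmall : ∀ᶠ Y : ℝ in atTop, K * Y ^ (-w) < ε := by
    have := (tendsto_rpow_neg_atTop hw).const_mul K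
    rw [mul_zero] at this
    exact this.eventually_lt_const hε
  obtain ⟨Y, ⟨S, P, -, -, -, -, -, -, -, -, hT⟩, hY0, hYε, hYv⟩ :=
    (hpen.and_eventually ((eventually_gt_atTop 0).and (hsmall.and
      (eventually_const_mul_rpow_lt (K / K ^ (-v)) (neg_lt_neg hvw))))).exists
  obtain ⟨c, -, hR, hRH, hRs⟩ := hT (Finset.Icc 1 N) subset_rfl (by simp)
  refine ⟨_, ⟨hR, K * Y, hRH,
    abs_pos.mpr (aeval_ne_zero_of_transcendental hξ hR.1.ne_zero), hRs.trans ?_⟩,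
    hRs.trans_lt hYε⟩
  have hKv : 0 < K ^ (-v) := by positivity
  rw [Real.mul_rpow (by linarith) hY0.le]
  rw [div_mul_eq_mul_div, div_lt_iff₀ hKv] at hYv
  linarith

/-! ### Roots near a point with small value and large derivative -/

/-- At ±r with r = 2ε/D the linear term has modulus at least 2ε, while the constant term and the sum
of the higher terms are each at most ε. Hence p(-r) ≤ 0 ≤ p(r). -/
lemma exists_root_of_coeff {p : ℝ[X]} {n : ℕ} (hp : p.natDegree ≤ n) {B ε D : ℝ}
    (hB : ∀ i, |p.coeff i| ≤ B) (hε : 0 ≤ ε) (hD : 0 < D) (h0 : |p.coeff 0| ≤ ε)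
    (h1 : D ≤ p.coeff 1) (hr : 2 * ε / D ≤ 1) (hBr : (n + 1) * B * (2 * ε / D) ≤ D / 2) :
    ∃ h : ℝ, |h| ≤ 2 * ε / D ∧ p.eval h = 0 := by
  obtain ⟨r, hrdef⟩ : ∃ r, r = 2 * ε / D := ⟨_, rfl⟩
  rw [← hrdef] at hr hBr ⊢
  have hr0 : 0 ≤ r := by rw [hrdef]; positivity
  have hrD : r * D = 2 * ε := by rw [hrdef]; field_simp
  have hB0 : 0 ≤ B := (abs_nonneg _).trans (hB 0)
  have taylor : ∀ h : ℝ, |h| = r → |p.eval h - p.coeff 0 - p.coeff 1 * h| ≤ ε := by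
    intro h hh
    have hsum : p.eval h - p.coeff 0 - p.coeff 1 * h =
        ∑ i ∈ Finset.range n, p.coeff (i + 2) * h ^ (i + 2) := by
      rw [eval_eq_sum_range' (show p.natDegree < n + 2 by omega), Finset.sum_range_succ',
        Finset.sum_range_succ']
      simp
    rw [hsum]
    refine (Finset.abs_sum_le_sum_abs _ _).trans ?_
    calc _ ≤ ∑ _i ∈ Finset.range n, B * r ^ 2 := by
          refine Finset.sum_le_sum fun i _ ↦ ?_
          rw [abs_mul, abs_pow, hh]
          exact mul_le_mul (hB _) (pow_le_pow_of_le_one hr0 hr (by omega)) (by positivity) hB0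
      _ = n * B * r * r := by rw [Finset.sum_const, Finset.card_range, nsmul_eq_mul]; ring
      _ ≤ (n + 1) * B * r * r := by gcongr; linarith
      _ ≤ D / 2 * r := by gcongr
      _ = ε := by linarith
  have hup := abs_le.mp (taylor r (abs_of_nonneg hr0))
  have hdn := abs_le.mp (taylor (-r) (by rw [abs_neg, abs_of_nonneg hr0]))
  have h0' := abs_le.mp h0
  have hmul : 2 * ε ≤ p.coeff 1 * r := by nlinarith
  obtain ⟨h, hh, hroot⟩ := intermediate_value_Icc (by linarith : -r ≤ r)
    (p.continuous.continuousOn) (show (0 : ℝ) ∈ Set.Icc (p.eval (-r)) (p.eval r) from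
      ⟨by linarith, by linarith⟩)
  exact ⟨h, abs_le.mpr hh, hroot⟩

lemma exists_root_near {P : ℤ[X]} {n : ℕ} (hP : P.natDegree ≤ n) {x Y ε D : ℝ}
    (hY : P.supNorm ≤ Y) (hD : 0 < D) (h0 : |aeval x P| ≤ ε)
    (h1 : D ≤ |aeval x (derivative P)|) (hr : 2 * ε / D ≤ 1)
    (hYr : (n + 1) * (taylorConst n x * Y) * (2 * ε / D) ≤ D / 2) :
    ∃ α : ℝ, |x - α| ≤ 2 * ε / D ∧ aeval α P = 0 := by
  set p := taylor x (P.map (Int.castRingHom ℝ)) with hp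
  have hε : 0 ≤ ε := (abs_nonneg _).trans h0
  have hT := zero_le_one.trans (one_le_taylorConst n x)
  have hpn : p.natDegree ≤ n := by
    rw [hp, natDegree_taylor]; exact natDegree_map_le.trans hP
  have hB : ∀ i, |p.coeff i| ≤ taylorConst n x * Y := fun i ↦
    (abs_taylor_coeff_le hP x i).trans (by gcongr)
  rw [← abs_taylor_coeff_zero] at h0
  rw [← abs_taylor_coeff_one] at h1
  obtain ⟨h, hh, hroot⟩ : ∃ h : ℝ, |h| ≤ 2 * ε / D ∧ p.eval h = 0 := by
    rcases le_abs.mp h1 with h1 | h1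
    · exact exists_root_of_coeff hpn hB hε hD h0 h1 hr hYr
    · obtain ⟨h, hh, hroot⟩ := exists_root_of_coeff (p := -p) (by rwa [natDegree_neg])
        (fun i ↦ by rw [coeff_neg, abs_neg]; exact hB i) hε hD
        (by rwa [coeff_neg, abs_neg]) (by rwa [coeff_neg]) hr hYr
      exact ⟨h, hh, by simpa using hroot⟩
  refine ⟨h + x, by rwa [show x - (h + x) = -h by ring, abs_neg], ?_⟩
  rw [aeval_eq_eval_map, ← taylor_eval]
  exact hroot

/-! ### Roots of unit polynomials -/

/-- By Gauss's lemma R stays irreducible over ℚ. The relation α · `R.divX`(α) = -R(0) = ±1 shows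
that α⁻¹ is ±`R.divX`(α), an algebraic integer. -/
lemma minpoly_of_isUnitPoly {n : ℕ} {R : ℤ[X]} (hR : IsUnitPoly n R) {α : ℝ}
    (hα : aeval α R = 0) :
    IsAlgUnit α ∧ (minpoly ℚ α).natDegree = n ∧ minpoly ℤ α = R := by
  obtain ⟨hi, hm, hd, h0⟩ := hR
  have hint : IsIntegral ℤ α := ⟨R, hm, by rwa [← aeval_def]⟩
  have hQ : R.map (algebraMap ℤ ℚ) = minpoly ℚ α :=
    minpoly.eq_of_irreducible_of_monic
      ((hm.irreducible_iff_irreducible_map_fraction_map (K := ℚ)).mp hi)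
      (by rwa [aeval_map_algebraMap]) (hm.map _)
  have hQ' := minpoly.isIntegrallyClosed_eq_field_fractions' ℚ hint
  have hX : α * aeval α R.divX = -(R.coeff 0 : ℝ) := by
    have h := congrArg (aeval α) (X_mul_divX_add R)
    rw [map_add, map_mul, aeval_X, aeval_C, hα] at h
    simp only [algebraMap_int_eq, eq_intCast] at h
    linarith
  have hα0 : α ≠ 0 := by
    rintro rfl
    rcases h0 with h0 | h0 <;> simp [h0] at hX
  have hdiv : IsIntegral ℤ (aeval α R.divX) :=
    adjoin_le_integralClosure hint (aeval_mem_adjoin_singleton ℤ α)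
  refine ⟨⟨hα0, hint, ?_⟩, ?_, ?_⟩
  · rcases h0 with h0 | h0
    · have : α⁻¹ = -aeval α R.divX := inv_eq_of_mul_eq_one_right (by rw [mul_neg, hX, h0]; simp)
      rw [this]; exact hdiv.neg
    · have : α⁻¹ = aeval α R.divX := inv_eq_of_mul_eq_one_right (by rw [hX, h0]; simp)
      rw [this]; exact hdiv
  · rw [← hQ, hm.natDegree_map, hd]
  · exact map_injective (algebraMap ℤ ℚ) (IsFractionRing.injective ℤ ℚ) (by rw [← hQ', hQ])

/-- To have infinitely many good approximations by algebraic units it suffices to find some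
arbitrarily close to, but different from, an auxiliary point `x`. -/
lemma infinite_unitRoot_of_forall {n : ℕ} {ξ t x : ℝ} (hξ : Transcendental ℚ ξ)
    (h : ∀ ε > 0, ∃ R : ℤ[X], IsUnitPoly n R ∧ ∃ α : ℝ, aeval α R = 0 ∧ α ≠ x ∧ |x - α| < ε ∧
      |ξ - α| ≤ R.supNorm ^ (-t - 1)) :
    {α : ℝ | IsAlgUnit α ∧ (minpoly ℚ α).natDegree = n ∧
      0 < |ξ - α| ∧ |ξ - α| ≤ (minpoly ℤ α).supNorm ^ (-t - 1)}.Infinite := by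
  suffices ({α : ℝ | IsAlgUnit α ∧ (minpoly ℚ α).natDegree = n ∧
      0 < |ξ - α| ∧ |ξ - α| ≤ (minpoly ℤ α).supNorm ^ (-t - 1)} ∩ {α | α ≠ x}).Infinite from
    this.mono Set.inter_subset_left
  refine infinite_of_forall_exists_lt (fun α ↦ |x - α|)
    (fun α hα ↦ abs_pos.mpr (sub_ne_zero.mpr (Ne.symm hα.2))) fun ε hε ↦ ?_
  obtain ⟨R, hR, α, hα, hαx, hαε, hαR⟩ := h ε hε
  obtain ⟨h1, h2, h3⟩ := minpoly_of_isUnitPoly hR hα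
  refine ⟨α, ⟨⟨h1, h2, ?_, by rwa [h3]⟩, hαx⟩, hαε⟩
  refine abs_pos.mpr (sub_ne_zero.mpr ?_)
  rintro rfl
  exact aeval_ne_zero_of_transcendental hξ hR.1.ne_zero hα

lemma eventually_const_mul_rpow_lt_const (K : ℝ) {p ε : ℝ} (hp : p < 0) (hε : 0 < ε) :
    ∀ᶠ Y : ℝ in atTop, K * Y ^ p < ε := by
  have := (tendsto_rpow_neg_atTop (neg_pos.mpr hp)).const_mul K
  rw [mul_zero, neg_neg] at this
  exact this.eventually_lt_const hε

lemma aeval_derivative_pencil (S P : ℤ[X]) (c : ℤ) (x : ℝ) :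
    aeval x (derivative (S + C c * (X * P))) =
      aeval x (derivative S) + c * (aeval x P + x * aeval x (derivative P)) := by
  simp [derivative_mul]

/-- At most one member of the pencil `S + c X P` has a derivative smaller than `η` at `x`, as soon
as `S` and `P` do not both have a derivative of size `O(η)`. -/
lemma card_le_one_of_derivative {S P : ℤ[X]} {x η δ : ℝ} {N : ℕ} (hx : x ≠ 0) (hη : 0 ≤ η)
    (hP : |aeval x P| ≤ δ)
    (h : |aeval x (derivative S)| ≤ (1 + 2 * N) * η →
      |aeval x (derivative P)| ≤ (2 * η + δ) / |x| → False) :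
    ((Finset.Icc (1 : ℤ) N).filter fun c ↦
      ¬ η ≤ |aeval x (derivative (S + C c * (X * P)))|).card ≤ 1 := by
  rw [Finset.card_le_one]
  intro c hc d hd
  by_contra hcd
  simp only [Finset.mem_filter, Finset.mem_Icc, not_le, aeval_derivative_pencil] at hc hd
  obtain ⟨⟨hc1, hcN⟩, hc⟩ := hc
  have hd := hd.2
  set s := aeval x (derivative S)
  set p := aeval x (derivative P)
  set g := aeval x P + x * p with hg
  -- The two derivatives differ by (c - d) g, and |c - d| ≥ 1.
  have hg2 : |g| ≤ 2 * η := by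
    have h1 : (1 : ℝ) ≤ |((c - d : ℤ) : ℝ)| := by
      exact_mod_cast Int.one_le_abs (sub_ne_zero.mpr hcd)
    have h2 : |((c - d : ℤ) : ℝ)| * |g| ≤ 2 * η := by
      rw [← abs_mul]
      have : ((c - d : ℤ) : ℝ) * g = (s + c * g) - (s + d * g) := by push_cast; ring
      rw [this]
      exact (abs_sub _ _).trans (by linarith)
    nlinarith [abs_nonneg g]
  refine h ?_ ?_
  · have hcN' : |(c : ℝ)| ≤ N := by
      rw [abs_of_nonneg (by exact_mod_cast (by omega : (0 : ℤ) ≤ c))]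
      exact_mod_cast hcN
    calc |s| = |(s + c * g) - c * g| := by ring_nf
      _ ≤ |s + c * g| + |(c : ℝ)| * |g| := by rw [← abs_mul]; exact abs_sub _ _
      _ ≤ η + N * (2 * η) := by gcongr
      _ = _ := by ring
  · rw [le_div_iff₀ (abs_pos.mpr hx), ← abs_mul]
    calc |p * x| = |g - aeval x P| := by rw [hg]; ring_nf
      _ ≤ |g| + |aeval x P| := abs_sub _ _
      _ ≤ _ := by linarith

/-- Approximation by roots of a member of the pencil with large derivative. -/
theorem infinite_unitRoot {m n : ℕ} (hm : 1 ≤ m) (hmn : m ≤ n) (hn : 2 ≤ n) {ξ w : ℝ}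
    (hξ : Transcendental ℚ ξ) (hw : (n : ℝ) - 2 < w) (hnw : 2 * (n : ℝ) - 7 < w)
    (hu : {P : ℤ[X] | IsUnitPoly m P ∧ ∃ X : ℝ, SmallAt ξ w X P}.Infinite)
    (hv : ∃ X₀ : ℝ, ∀ X : ℝ, X₀ ≤ X → ∃ P : ℤ[X], P.natDegree ≤ n - 2 ∧ SmallAt ξ w X P) :
    {α : ℝ | IsAlgUnit α ∧ (minpoly ℚ α).natDegree = n ∧ 0 < |ξ - α| ∧
      |ξ - α| ≤ (minpoly ℤ α).supNorm ^ (-(3 / 2 * w - n + 1 / 2) - 1)}.Infinite := by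
  have hn2 : (2 : ℝ) ≤ n := by exact_mod_cast hn
  have hw0 : 0 < w := by linarith
  have hξ0 : ξ ≠ 0 := by
    have := aeval_ne_zero_of_transcendental hξ (X_ne_zero (R := ℤ))
    simpa using this
  obtain ⟨N, K, hK, hpen⟩ := exists_pencil hm hmn hn hξ hw0 hnw hu hv
  -- The first bound gives 1 - w < 2q, needed to locate the root; the second keeps w + q above 3/2 w
  -- - n + 3/2.
  obtain ⟨θ, hθ⟩ : ∃ θ : ℝ, θ = min ((w - n + 2) / 2) (1 / 2) := ⟨_, rfl⟩
  have hθ0 : 0 < θ := by rw [hθ]; exact lt_min (by linarith) (by norm_num)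
  have hθ1 : θ ≤ (w - n + 2) / 2 := by rw [hθ]; exact min_le_left _ _
  have hθ2 : θ ≤ 1 / 2 := by rw [hθ]; exact min_le_right _ _
  -- Up to θ, this solves -w + 2q + (2n - 5) = 0, the balance in the third order resultant bound.
  obtain ⟨q, hq⟩ : ∃ q : ℝ, q = (w - 2 * n + 5) / 2 - θ := ⟨_, rfl⟩
  obtain ⟨B, hB⟩ : ∃ B : ℝ, B = taylorConst n ξ * K := ⟨_, rfl⟩
  have hB1 : 1 ≤ B := by
    rw [hB]; exact one_le_mul_of_one_le_of_one_le (one_le_taylorConst n ξ) hK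
  obtain ⟨L, hL⟩ : ∃ L : ℝ, L = 1 + 2 * N + (2 + K) / |ξ| + K := ⟨_, rfl⟩
  have hKξ : 0 < (2 + K) / |ξ| := div_pos (by linarith) (abs_pos.mpr hξ0)
  have hN0 : (0 : ℝ) ≤ N := Nat.cast_nonneg N
  refine infinite_unitRoot_of_forall (x := ξ) hξ fun ε hε ↦ ?_
  obtain ⟨Y, ⟨S, P, hP0, hSn, hPn, hcop, hSH, hPH, hSs, hPs, hT⟩, hY1, hYlt, hE1, hE2, hE3, hE4,
    hE5⟩ := (hpen.and_eventually ((eventually_gt_atTop 1).and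
    ((eventually_const_mul_rpow_lt_const K (p := -w) (by linarith) one_pos).and
    ((eventually_const_mul_rpow_lt_const
      ((2 * n).factorial * (K * L ^ 2 * B ^ (2 * n - 5))) (p := -(2 * θ)) (by linarith)
      (by norm_num : (0 : ℝ) < 1 / 2)).and
    ((eventually_const_mul_rpow_lt_const
      ((2 * n).factorial * (K ^ 2 * B ^ (2 * n - 4))) (p := -2 * w + (2 * n - 4)) (by linarith)
      (by norm_num : (0 : ℝ) < 1 / 2)).and
    ((eventually_const_mul_rpow_lt (4 * ((n + 1) * B * K)) (p := 1 - w - q) (q := q)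
      (by linarith)).and
    ((eventually_const_mul_rpow_lt_const (2 * K) (p := -w - q) (by linarith)
      (lt_min one_pos hε)).and
    (eventually_const_mul_rpow_lt (2 * K / K ^ (-(3 / 2 * w - n + 1 / 2) - 1)) (p := -w - q)
      (q := -(3 / 2 * w - n + 1 / 2) - 1) (by linarith))))))))).exists
  have hY0 : 0 < Y := by linarith
  have hKY : 1 ≤ K * Y := one_le_mul_of_one_le_of_one_le hK hY1.le
  have hBY : taylorConst n ξ * (K * Y) = B * Y := by rw [hB]; ring
  have hBY1 : 1 ≤ B * Y := one_le_mul_of_one_le_of_one_le hB1 hY1.le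
  -- A nonzero integer constant is not below 1 in modulus. This yields n ≥ 3 and a degree sum of at
  -- least 3.
  have hPdeg : 1 ≤ P.natDegree := by
    by_contra! hd
    rw [Nat.lt_one_iff] at hd
    rw [eq_C_of_natDegree_eq_zero hd, aeval_C] at hPs
    have hc : P.coeff 0 ≠ 0 := fun h ↦ hP0 (by rw [eq_C_of_natDegree_eq_zero hd, h, C_0])
    have : (1 : ℝ) ≤ |((P.coeff 0 : ℤ) : ℝ)| := by exact_mod_cast Int.one_le_abs hc
    simp only [algebraMap_int_eq, eq_intCast] at hPs
    linarith
  have hn3 : 3 ≤ n := by omega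
  have hn3' : (3 : ℝ) ≤ n := by exact_mod_cast hn3
  have hYq : 0 < Y ^ q := by positivity
  have hYw : 0 < Y ^ (-w) := by positivity
  have hwq : Y ^ (-w) ≤ Y ^ q := Real.rpow_le_rpow_of_exponent_le hY1.le (by linarith)
  have hKw : K * Y ^ (-w) ≤ K * Y ^ q := by gcongr
  -- The degree sum is at most 2n - 2. The two terms of the bound are O(Y^(-2θ)) and O(Y^(-2w + 2n -
  -- 4)), both tending to 0 because w > n - 2.
  have hderiv : |aeval ξ (derivative S)| ≤ (1 + 2 * N) * Y ^ q →
      |aeval ξ (derivative P)| ≤ (2 * Y ^ q + K * Y ^ (-w)) / |ξ| → False := by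
    intro hS hP
    have hS' : |aeval ξ (derivative S)| ≤ L * Y ^ q := hS.trans (by gcongr; linarith)
    have hP' : |aeval ξ (derivative P)| ≤ L * Y ^ q := by
      refine hP.trans ?_
      calc _ ≤ (2 * Y ^ q + K * Y ^ q) / |ξ| := by gcongr
        _ = (2 + K) / |ξ| * Y ^ q := by ring
        _ ≤ _ := by gcongr; linarith
    have key := one_le_of_resultant_ne_zero_of_derivative
      (resultant_ne_zero_of_isCoprime_map hcop) (n := n) hSn.le (by omega) (by omega) hSH hPH
      (hKw.trans (by gcongr; linarith)) hSs hPs hS' hP'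
    rw [hBY] at key
    have hfac : ((S.natDegree + P.natDegree).factorial : ℝ) ≤ (2 * n).factorial := by
      exact_mod_cast Nat.factorial_le (by omega)
    have hpow : (B * Y) ^ (S.natDegree + P.natDegree - 3) ≤ (B * Y) ^ (2 * n - 5) :=
      pow_le_pow_right₀ hBY1 (by omega)
    have hYn : Y ^ (2 * n - 5) = Y ^ (2 * (n : ℝ) - 5) := by
      rw [← Real.rpow_natCast, Nat.cast_sub (by omega)]; push_cast; rfl
    have hYn' : Y ^ (2 * n - 4) = Y ^ (2 * (n : ℝ) - 4) := by
      rw [← Real.rpow_natCast, Nat.cast_sub (by omega)]; push_cast; rfl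
    have e1 : Y ^ (-w) * (Y ^ q) ^ 2 * Y ^ (2 * n - 5) = Y ^ (-(2 * θ)) := by
      rw [hYn, ← Real.rpow_mul_natCast hY0.le, ← Real.rpow_add hY0, ← Real.rpow_add hY0]
      congr 1; rw [hq]; push_cast; ring
    have e2 : (Y ^ (-w)) ^ 2 * Y ^ (2 * n - 4) = Y ^ (-2 * w + (2 * n - 4)) := by
      rw [hYn', ← Real.rpow_mul_natCast hY0.le, ← Real.rpow_add hY0]
      congr 1; push_cast; ring
    have e3 : (B * Y) * (B * Y) ^ (2 * n - 5) = B ^ (2 * n - 4) * Y ^ (2 * n - 4) := by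
      rw [← pow_succ', ← mul_pow]; congr 1; omega
    have hle : ((S.natDegree + P.natDegree).factorial : ℝ) *
        ((K * Y ^ (-w) * (L * Y ^ q) ^ 2 + (K * Y ^ (-w)) ^ 2 * (B * Y)) *
          (B * Y) ^ (S.natDegree + P.natDegree - 3)) ≤ (2 * n).factorial *
        ((K * Y ^ (-w) * (L * Y ^ q) ^ 2 + (K * Y ^ (-w)) ^ 2 * (B * Y)) *
          (B * Y) ^ (2 * n - 5)) := by gcongr
    have heq : ((2 * n).factorial : ℝ) *
        ((K * Y ^ (-w) * (L * Y ^ q) ^ 2 + (K * Y ^ (-w)) ^ 2 * (B * Y)) *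
          (B * Y) ^ (2 * n - 5)) =
        (2 * n).factorial * (K * L ^ 2 * B ^ (2 * n - 5)) * Y ^ (-(2 * θ)) +
        (2 * n).factorial * (K ^ 2 * B ^ (2 * n - 4)) * Y ^ (-2 * w + (2 * n - 4)) := by
      rw [← e1, ← e2]
      have : (K * Y ^ (-w) * (L * Y ^ q) ^ 2 + (K * Y ^ (-w)) ^ 2 * (B * Y)) *
          (B * Y) ^ (2 * n - 5) = K * Y ^ (-w) * (L * Y ^ q) ^ 2 * (B * Y) ^ (2 * n - 5) +
            (K * Y ^ (-w)) ^ 2 * ((B * Y) * (B * Y) ^ (2 * n - 5)) := by ring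
      rw [this, e3, mul_pow B Y]; ring
    linarith
  have hcard := card_le_one_of_derivative (N := N) hξ0 hYq.le hPs hderiv
  obtain ⟨c, hc, hR, hRH, hRs⟩ := hT
    ((Finset.Icc (1 : ℤ) N).filter fun c ↦
      Y ^ q ≤ |aeval ξ (derivative (S + C c * (X * P)))|) (Finset.filter_subset _ _) (by
        have := Finset.card_filter_add_card_filter_not (s := Finset.Icc (1 : ℤ) N)
          (fun c ↦ Y ^ q ≤ |aeval ξ (derivative (S + C c * (X * P)))|)
        rw [Int.card_Icc] at this
        omega)
  have hcd := (Finset.mem_filter.mp hc).2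
  have hr : 2 * (K * Y ^ (-w)) / Y ^ q = 2 * K * Y ^ (-w - q) := by
    rw [Real.rpow_sub hY0]; ring
  obtain ⟨α, hα, hroot⟩ := exists_root_near hR.2.2.1.le hRH hYq hRs hcd
    (by rw [hr]; exact (hE4.trans_le (min_le_left _ _)).le) (by
      rw [hr, hBY]
      have : Y ^ (1 - w - q) = Y * Y ^ (-w - q) := by
        rw [show 1 - w - q = 1 + (-w - q) by ring, Real.rpow_add hY0, Real.rpow_one]
      rw [this] at hE3
      linarith)
  rw [hr] at hα
  refine ⟨_, hR, α, hroot, ?_, hα.trans_lt (hE4.trans_le (min_le_right _ _)), ?_⟩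
  · rintro rfl
    exact aeval_ne_zero_of_transcendental hξ hR.1.ne_zero hroot
  · have hKt : 0 < K ^ (-(3 / 2 * w - n + 1 / 2) - 1) := by positivity
    rw [div_mul_eq_mul_div, div_lt_iff₀ hKt] at hE5
    calc _ ≤ 2 * K * Y ^ (-w - q) := hα
      _ ≤ (K * Y) ^ (-(3 / 2 * w - n + 1 / 2) - 1) := by
          rw [Real.mul_rpow (by linarith) hY0.le]; linarith
      _ ≤ _ := Real.rpow_le_rpow_of_nonpos
          (lt_of_lt_of_le one_pos (one_le_supNorm hR.1.ne_zero)) hRH (by linarith)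

/-! ### Explicit families of unit polynomials of degree at most four -/

lemma eval_eq_zero_of_linear_factor {P A : ℤ[X]} (hP0 : P.coeff 0 = 1 ∨ P.coeff 0 = -1)
    (hA : A.Monic) (hA1 : A.natDegree = 1) (hAP : A ∣ P) : P.eval 1 = 0 ∨ P.eval (-1) = 0 := by
  obtain ⟨B, rfl⟩ := hAP
  rw [eval_mul, eval_mul, hA.eq_X_add_C hA1]
  rcases coeff_zero_isUnit_of_dvd (dvd_mul_right A B) hP0 with h | h <;> simp [h]

/-- A proper factorization would contain a linear factor, and its constant coefficient ±1 puts a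
root at 1 or -1. -/
lemma irreducible_of_natDegree_le_three {P : ℤ[X]} (hP : P.Monic)
    (hP0 : P.coeff 0 = 1 ∨ P.coeff 0 = -1) (hd1 : 1 ≤ P.natDegree)
    (hd3 : P.natDegree ≤ 3) (h1 : P.eval 1 ≠ 0) (h2 : P.eval (-1) ≠ 0) :
    Irreducible P := by
  rw [hP.irreducible_iff_natDegree']
  refine ⟨by rintro rfl; simp at hd1, fun A B hA hB hAB hBd ↦ ?_⟩
  rw [Finset.mem_Ioc] at hBd
  exact (eval_eq_zero_of_linear_factor hP0 hB (by omega) ⟨A, by rw [← hAB, mul_comm]⟩).elim h1 h2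

/-- The polynomial `X ^ n + (2 a + 1) X + 1`. -/
noncomputable def trinomial (n : ℕ) (a : ℤ) : ℤ[X] := X ^ n + (C (2 * a + 1) * X + 1)

lemma trinomial_coeff_one {n : ℕ} (hn : 2 ≤ n) (a : ℤ) : (trinomial n a).coeff 1 = 2 * a + 1 := by
  simp [trinomial, coeff_X_pow, coeff_one, show 1 ≠ n by omega]

lemma isUnitPoly_trinomial {n : ℕ} (hn : 2 ≤ n) (hn3 : n ≤ 3) (a : ℤ) :
    IsUnitPoly n (trinomial n a) := by
  have hlin : (C (2 * a + 1) * X + 1 : ℤ[X]).natDegree ≤ 1 := by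
    simpa using natDegree_linear_le (a := 2 * a + 1) (b := (1 : ℤ))
  have hlin' : (C (2 * a + 1) * X + 1 : ℤ[X]).degree < n :=
    (natDegree_le_iff_degree_le.mp hlin).trans_lt (by exact_mod_cast (by omega : 1 < n))
  have hm : (trinomial n a).Monic := monic_X_pow_add hlin'
  have hd : (trinomial n a).natDegree = n := by
    rw [trinomial, natDegree_add_eq_left_of_natDegree_lt] <;> rw [natDegree_X_pow]
    omega
  have h0 : (trinomial n a).coeff 0 = 1 := by
    simp [trinomial, coeff_X_pow, show 0 ≠ n by omega]
  refine ⟨irreducible_of_natDegree_le_three hm (Or.inl h0) (by omega) (by omega) ?_ ?_, hm, hd,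
    Or.inl h0⟩
  -- The values at 1 and -1 are odd.
  · simp only [trinomial, eval_add, eval_pow, eval_X, eval_mul, eval_C, eval_one, one_pow]
    omega
  · simp only [trinomial, eval_add, eval_pow, eval_X, eval_mul, eval_C, eval_one]
    rcases neg_one_pow_eq_or ℤ n with h | h <;> rw [h] <;> omega

lemma supNorm_trinomial {n : ℕ} (hn : 2 ≤ n) (a : ℕ) : (trinomial n a).supNorm = 2 * a + 1 := by
  refine le_antisymm (supNorm_le_of_forall fun i ↦ ?_) ?_
  · have h1 : (1 : ℝ) ≤ 2 * a + 1 := by linarith [Nat.cast_nonneg (α := ℝ) a]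
    have h2 : |(2 * (a : ℝ) + 1)| = 2 * a + 1 := abs_of_nonneg (by linarith)
    match i with
    | 0 => simp [trinomial, coeff_X_pow, show 0 ≠ n by omega]
    | 1 => rw [trinomial_coeff_one hn]; push_cast; exact h2.le
    | i + 2 =>
      rw [trinomial, coeff_add, coeff_X_pow, coeff_add, coeff_C_mul, coeff_X_of_ne_one (by omega),
        coeff_one, if_neg (by omega : i + 2 ≠ 0)]
      split_ifs
      · simp
      · simp; linarith
  · have := norm_coeff_le_supNorm (trinomial n a) 1
    rw [trinomial_coeff_one hn] at this
    push_cast at this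
    exact (le_abs_self _).trans this

lemma aeval_derivative_trinomial_zero {n : ℕ} (hn : 2 ≤ n) (a : ℤ) :
    aeval (0 : ℝ) (derivative (trinomial n a)) = 2 * a + 1 := by
  rw [aeval_eq_eval_map, ← derivative_map, ← taylor_coeff_one, taylor_zero, coeff_map,
    trinomial_coeff_one hn]
  simp

/-- For v < 0 the bound X^(-v) tends to infinity, so every trinomial satisfies the system for large
X. -/
lemma infinite_unitPoly_of_neg {n : ℕ} (hn : 2 ≤ n) (hn3 : n ≤ 3) {ξ v : ℝ}
    (hξ : Transcendental ℚ ξ) (hv : v < 0) :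
    {P : ℤ[X] | IsUnitPoly n P ∧ ∃ X : ℝ, SmallAt ξ v X P}.Infinite := by
  refine Set.infinite_of_injective_forall_mem (f := fun a : ℤ ↦ trinomial n a) ?_ fun a ↦ ?_
  · intro a b hab
    have := congrArg (fun P : ℤ[X] ↦ P.coeff 1) hab
    simp only [trinomial_coeff_one hn] at this
    omega
  · have hR := isUnitPoly_trinomial hn hn3 a
    obtain ⟨Y, hY1, hY2⟩ := ((eventually_ge_atTop (trinomial n a).supNorm).and
      ((tendsto_rpow_atTop (neg_pos.mpr hv)).eventually_ge_atTop |aeval ξ (trinomial n a)|)).exists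
    exact ⟨hR, Y, hY1, abs_pos.mpr (aeval_ne_zero_of_transcendental hξ hR.1.ne_zero), hY2⟩

/-- Since -t - 1 > 0, the bound grows with the height and bounded roots suffice. A trinomial has
value 1 and slope 2a + 1 at 0, hence a root near 0 for large a. -/
lemma infinite_unitRoot_of_lt_neg_one {n : ℕ} (hn : 2 ≤ n) (hn3 : n ≤ 3) {ξ t : ℝ}
    (hξ : Transcendental ℚ ξ) (ht : t < -1) :
    {α : ℝ | IsAlgUnit α ∧ (minpoly ℚ α).natDegree = n ∧ 0 < |ξ - α| ∧
      |ξ - α| ≤ (minpoly ℤ α).supNorm ^ (-t - 1)}.Infinite := by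
  refine infinite_unitRoot_of_forall (x := 0) hξ fun ε hε ↦ ?_
  have hnat : Tendsto (fun a : ℕ ↦ 2 * (a : ℝ) + 1) atTop atTop :=
    (tendsto_natCast_atTop_atTop.const_mul_atTop two_pos).atTop_add tendsto_const_nhds
  obtain ⟨a, ha1, ha2, ha3⟩ := (((hnat.eventually_gt_atTop (2 / min 1 ε)).and
    ((hnat.eventually_ge_atTop (4 * ((n + 1) * taylorConst n 0))).and
    (((tendsto_rpow_atTop (by linarith : 0 < -t - 1)).comp hnat).eventually_ge_atTop
      (|ξ| + 1))))).exists
  have hY : 0 < 2 * (a : ℝ) + 1 := by positivity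
  have hm : 0 < min 1 ε := lt_min one_pos hε
  have hR := isUnitPoly_trinomial hn hn3 a
  have hr : 2 * 1 / (2 * (a : ℝ) + 1) < min 1 ε := by
    rw [mul_one, div_lt_iff₀ hY]
    rw [div_lt_iff₀ hm] at ha1
    linarith
  have hn0 : n ≠ 0 := by omega
  obtain ⟨α, hα, hroot⟩ := exists_root_near hR.2.2.1.le (x := 0) (ε := 1) (D := 2 * a + 1)
    (supNorm_trinomial hn a).le hY (by simp [trinomial, hn0])
    (by rw [aeval_derivative_trinomial_zero hn]; exact le_abs_self _)
    (hr.le.trans (min_le_left _ _)) (by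
      have : (n + 1) * (taylorConst n 0 * (2 * (a : ℝ) + 1)) * (2 * 1 / (2 * (a : ℝ) + 1)) =
        2 * ((n + 1) * taylorConst n 0) := by field_simp
      rw [this]; linarith)
  refine ⟨_, hR, α, hroot, (minpoly_of_isUnitPoly hR hroot).1.1,
    hα.trans_lt (hr.trans_le (min_le_right _ _)), ?_⟩
  rw [supNorm_trinomial hn]
  rw [zero_sub, abs_neg] at hα
  have := hr.trans_le (min_le_left _ _)
  exact (abs_sub _ _).trans ((by linarith : |ξ| + |α| ≤ |ξ| + 1).trans ha3)

/-- The quartic `X ^ 4 + 4 b X ^ 2 + 4 a X + 1`. -/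
noncomputable def quartic (a b : ℤ) : ℤ[X] := X ^ 4 + (C (4 * b) * X ^ 2 + C (4 * a) * X + 1)

lemma monic_quadratic_eq {A : ℤ[X]} (hA : A.Monic) (h2 : A.natDegree = 2) :
    A = X ^ 2 + C (A.coeff 1) * X + C (A.coeff 0) := by
  conv_lhs => rw [A.as_sum_range_C_mul_X_pow, h2]
  have : A.coeff 2 = 1 := by rw [← h2]; exact hA
  simp [Finset.sum_range_succ, this]
  ring

/-- Irreducibility is seen modulo 4. The values at ±1 are 2 modulo 4, which excludes linear factors.
Two quadratic factors would have opposite linear coefficients ±p and equal constants ±1, forcing p²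
≡ 2. -/
lemma isUnitPoly_quartic (a b : ℤ) : IsUnitPoly 4 (quartic a b) := by
  have hlow : (C (4 * b) * X ^ 2 + C (4 * a) * X + 1 : ℤ[X]).natDegree ≤ 2 := by
    simpa using natDegree_quadratic_le (a := 4 * b) (b := 4 * a) (c := (1 : ℤ))
  have hm : (quartic a b).Monic :=
    monic_X_pow_add ((natDegree_le_iff_degree_le.mp hlow).trans_lt (by norm_num))
  have hd : (quartic a b).natDegree = 4 := by
    rw [quartic, natDegree_add_eq_left_of_natDegree_lt] <;> rw [natDegree_X_pow]
    omega
  have h0 : (quartic a b).coeff 0 = 1 := by simp [quartic]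
  refine ⟨?_, hm, hd, Or.inl h0⟩
  rw [hm.irreducible_iff_natDegree']
  refine ⟨by intro h; rw [h] at hd; simp at hd, fun A B hA hB hAB hBd ↦ ?_⟩
  rw [hd, Finset.mem_Ioc] at hBd
  have hsum : A.natDegree + B.natDegree = 4 := by rw [← hA.natDegree_mul hB, hAB, hd]
  rcases (by omega : B.natDegree = 1 ∨ B.natDegree = 2) with h | h
  · have := eval_eq_zero_of_linear_factor (Or.inl h0) hB h ⟨A, by rw [← hAB, mul_comm]⟩
    simp only [quartic, eval_add, eval_pow, eval_X, eval_mul, eval_C, eval_one] at this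
    omega
  · have hprod := hAB
    rw [monic_quadratic_eq hA (by omega), monic_quadratic_eq hB h] at hprod
    set p := A.coeff 1
    set e := A.coeff 0
    set q := B.coeff 1
    set f := B.coeff 0
    have hexp : (X ^ 2 + C p * X + C e) * (X ^ 2 + C q * X + C f) =
        X ^ 4 + C (p + q) * X ^ 3 + C (e + f + p * q) * X ^ 2 + C (p * f + q * e) * X +
          C (e * f) := by
      simp only [C_add, C_mul]; ring
    rw [hexp, quartic] at hprod
    have c0 := congrArg (fun P : ℤ[X] ↦ P.coeff 0) hprod
    have c2 := congrArg (fun P : ℤ[X] ↦ P.coeff 2) hprod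
    have c3 := congrArg (fun P : ℤ[X] ↦ P.coeff 3) hprod
    simp only [coeff_add, coeff_C_mul, coeff_X_pow, coeff_X, coeff_C, coeff_one] at c0 c2 c3
    norm_num at c0 c2 c3
    have hef : e = 1 ∧ f = 1 ∨ e = -1 ∧ f = -1 := by
      have := Int.mul_eq_one_iff_eq_one_or_neg_one.mp c0
      tauto
    have hq : q = -p := by linarith
    have hp2 : p * p % 4 = 0 ∨ p * p % 4 = 1 := by
      rcases Int.even_or_odd' p with ⟨k, hk | hk⟩ <;> rw [hk] <;> ring_nf <;> omega
    rw [hq, mul_neg] at c2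
    omega

lemma supNorm_quartic_le (a b : ℤ) {M : ℝ} (hM : 1 ≤ M) (ha : |4 * (a : ℝ)| ≤ M)
    (hb : |4 * (b : ℝ)| ≤ M) : (quartic a b).supNorm ≤ M := by
  refine supNorm_le_of_forall fun i ↦ ?_
  have hM0 : 0 ≤ M := by linarith
  match i with
  | 0 => simpa [quartic] using hM
  | 1 =>
    simp only [quartic, coeff_add, coeff_X_pow, coeff_C_mul, coeff_X, coeff_one]
    norm_num
    simpa using ha
  | 2 =>
    simp only [quartic, coeff_add, coeff_X_pow, coeff_C_mul, coeff_X, coeff_one]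
    norm_num
    simpa using hb
  | i + 3 =>
    rw [quartic, coeff_add, coeff_add, coeff_add, coeff_X_pow, coeff_C_mul, coeff_C_mul,
      coeff_X_pow, coeff_X_of_ne_one (by omega), coeff_one, if_neg (by omega : i + 3 ≠ 0),
      if_neg (by omega : i + 3 ≠ 2)]
    split_ifs
    · simpa using hM
    · simpa using hM0

lemma aeval_quartic (a b : ℤ) (x : ℝ) :
    aeval x (quartic a b) = x ^ 4 + 4 * b * x ^ 2 + 4 * a * x + 1 := by
  have h : ∀ p q : ℤ, aeval x (X ^ 4 + (C p * X ^ 2 + C q * X + 1) : ℤ[X]) =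
      x ^ 4 + (p * x ^ 2 + q * x + 1) := fun p q ↦ by simp
  rw [quartic, h]
  push_cast
  ring

lemma aeval_derivative_quartic (a b : ℤ) (x : ℝ) :
    aeval x (derivative (quartic a b)) = 4 * x ^ 3 + 8 * b * x + 4 * a := by
  have h : ∀ p q : ℤ, aeval x (derivative (X ^ 4 + (C p * X ^ 2 + C q * X + 1) : ℤ[X])) =
      4 * x ^ 3 + (p * (2 * x) + q) := fun p q ↦ by simp [aeval_eq_eval_map]
  rw [quartic, h]
  push_cast
  ring

/-- A large b gives slope of order b at ξ, and rounding the real solution y to a keeps the value at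
most 2|ξ|. This puts a root within 2/b of ξ at height O(b), better than the required power -1/2 of
the height. -/
lemma infinite_unitRoot_four {ξ t : ℝ} (hξ : Transcendental ℚ ξ) (ht : t ≤ -1 / 2) :
    {α : ℝ | IsAlgUnit α ∧ (minpoly ℚ α).natDegree = 4 ∧ 0 < |ξ - α| ∧
      |ξ - α| ≤ (minpoly ℤ α).supNorm ^ (-t - 1)}.Infinite := by
  have hξ0 : ξ ≠ 0 := by
    have := aeval_ne_zero_of_transcendental hξ (X_ne_zero (R := ℤ))
    simpa using this
  have hx : 0 < |ξ| := abs_pos.mpr hξ0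
  refine infinite_unitRoot_of_forall (x := ξ) hξ fun ε hε ↦ ?_
  obtain ⟨M₀, hM₀⟩ : ∃ M₀ : ℝ, M₀ = |ξ ^ 4 + 1| / |ξ| + 4 * |ξ| + 6 := ⟨_, rfl⟩
  have hM₀' : 6 ≤ M₀ := by
    have : 0 ≤ |ξ ^ 4 + 1| / |ξ| := by positivity
    linarith
  obtain ⟨c, hc⟩ : ∃ c : ℝ, c = 2 + |1 / ξ| + |3 * ξ ^ 3| := ⟨_, rfl⟩
  obtain ⟨b, hb1, hb2, hb3, hb4, hb5⟩ := (((tendsto_natCast_atTop_atTop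
    (R := ℝ)).eventually_gt_atTop (2 / min 1 ε)).and
    ((tendsto_natCast_atTop_atTop.eventually_ge_atTop (c / (2 * |ξ|))).and
    ((tendsto_natCast_atTop_atTop.eventually_ge_atTop
      (2 * (5 * (taylorConst 4 ξ * M₀)) / |ξ|)).and
    ((tendsto_natCast_atTop_atTop.eventually_ge_atTop (4 * M₀)).and
    (tendsto_natCast_atTop_atTop.eventually_ge_atTop 1))))).exists
  have hb0 : (0 : ℝ) < b := by linarith
  obtain ⟨y, hy⟩ : ∃ y : ℝ, y = -((ξ ^ 4 + 1) / ξ + 4 * b * ξ) / 4 := ⟨_, rfl⟩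
  obtain ⟨a, ha⟩ : ∃ a : ℤ, a = round y := ⟨_, rfl⟩
  have hay : |y - a| ≤ 1 / 2 := by rw [ha]; exact abs_sub_round y
  have hR := isUnitPoly_quartic a b
  have hval : aeval ξ (quartic a b) = 4 * ξ * (a - y) := by
    rw [hy, aeval_quartic, Int.cast_natCast]
    field_simp
    ring
  have hval' : |aeval ξ (quartic a b)| ≤ 2 * |ξ| := by
    rw [hval, abs_mul, abs_mul, abs_sub_comm]
    norm_num
    nlinarith
  have hder : aeval ξ (derivative (quartic a b)) =
      4 * b * ξ + (4 * (a - y) + (3 * ξ ^ 3 - 1 / ξ)) := by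
    rw [hy, aeval_derivative_quartic, Int.cast_natCast]
    field_simp
    ring
  have hsmall : |4 * (a - y) + (3 * ξ ^ 3 - 1 / ξ)| ≤ c := by
    have h1 := abs_add_le (4 * (a - y)) (3 * ξ ^ 3 - 1 / ξ)
    have h2 := abs_sub (3 * ξ ^ 3) (1 / ξ)
    have h3 : |4 * (a - y)| ≤ 2 := by
      rw [abs_mul, abs_sub_comm]; norm_num; linarith
    linarith
  have hder' : 2 * b * |ξ| ≤ |aeval ξ (derivative (quartic a b))| := by
    rw [hder]
    have h1 := abs_sub_abs_le_abs_add (4 * b * ξ) (4 * (a - y) + (3 * ξ ^ 3 - 1 / ξ))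
    have h2 : |4 * b * ξ| = 4 * b * |ξ| := by
      rw [abs_mul, abs_of_nonneg (by positivity)]
    rw [div_le_iff₀ (by positivity)] at hb2
    linarith
  have hsup : (quartic a b).supNorm ≤ M₀ * b := by
    refine supNorm_quartic_le a b (by nlinarith) ?_ ?_
    · have h1 : |4 * (a : ℝ)| ≤ 2 + |4 * y| := by
        have h2 := abs_add_le (4 * (a - y)) (4 * y)
        have h3 : |4 * (a - y)| ≤ 2 := by
          rw [abs_mul, abs_sub_comm]; norm_num; linarith
        rw [show 4 * (a - y) + 4 * y = 4 * (a : ℝ) by ring] at h2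
        linarith
      have h4 : |4 * y| ≤ |ξ ^ 4 + 1| / |ξ| + 4 * b * |ξ| := by
        rw [hy, show 4 * (-((ξ ^ 4 + 1) / ξ + 4 * b * ξ) / 4) =
          -((ξ ^ 4 + 1) / ξ + 4 * b * ξ) by ring, abs_neg]
        refine (abs_add_le _ _).trans_eq ?_
        rw [abs_div, abs_mul, abs_of_nonneg (by positivity : (0 : ℝ) ≤ 4 * b)]
      have h5 : 0 ≤ |ξ ^ 4 + 1| / |ξ| := by positivity
      rw [hM₀]
      nlinarith
    · push_cast
      rw [abs_of_nonneg (by positivity)]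
      nlinarith
  have hr : 2 * (2 * |ξ|) / (2 * b * |ξ|) = 2 / b := by field_simp
  have hr1 : 2 / (b : ℝ) < min 1 ε := by
    rw [div_lt_iff₀ hb0]
    rw [div_lt_iff₀ (lt_min one_pos hε)] at hb1
    linarith
  obtain ⟨α, hα, hroot⟩ := exists_root_near hR.2.2.1.le (x := ξ) hsup (by positivity) hval'
    hder' (by rw [hr]; exact (hr1.trans_le (min_le_left _ _)).le) (by
      rw [hr]
      have : ((4 : ℕ) + 1 : ℝ) * (taylorConst 4 ξ * (M₀ * b)) * (2 / b) =
        2 * (5 * (taylorConst 4 ξ * M₀)) := by push_cast; field_simp; ring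
      rw [this]
      rw [div_le_iff₀ hx] at hb3
      linarith)
  rw [hr] at hα
  refine ⟨_, hR, α, hroot, ?_, hα.trans_lt (hr1.trans_le (min_le_right _ _)), hα.trans ?_⟩
  · rintro rfl
    exact aeval_ne_zero_of_transcendental hξ hR.1.ne_zero hroot
  · have hH1 := one_le_supNorm hR.1.ne_zero
    -- As b ≥ 4 M₀, the height is at most M₀ b ≤ (b/2)².
    calc 2 / (b : ℝ) ≤ ((b : ℝ) / 2) ^ (-1 : ℝ) := by
          rw [Real.rpow_neg_one, inv_div]
      _ = (((b : ℝ) / 2) ^ (2 : ℝ)) ^ (-(1 / 2) : ℝ) := by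
          rw [← Real.rpow_mul (by positivity)]; norm_num
      _ ≤ (quartic a b).supNorm ^ (-(1 / 2) : ℝ) := by
          refine Real.rpow_le_rpow_of_nonpos (by linarith) (hsup.trans ?_) (by norm_num)
          rw [Real.rpow_two]
          nlinarith
      _ ≤ _ := Real.rpow_le_rpow_of_exponent_le hH1 (by linarith)

/-! ### Dirichlet's theorem for the uniform exponent -/

/-- Box principle: (H + 1)^(d + 1) polynomials with coefficients in [0, H] take values in [-LH, LH],
where L is the Taylor constant. Boxes of length 2L/H^d number H^(d + 1) + 1, counting the endpoint,
which is fewer as d ≥ 1. -/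
lemma exists_small_of_pos {d : ℕ} (hd : 1 ≤ d) (ξ : ℝ) {H : ℕ} (hH : 1 ≤ H) :
    ∃ P : ℤ[X], P ≠ 0 ∧ P.natDegree ≤ d ∧ P.supNorm ≤ H ∧
      |aeval ξ P| ≤ 2 * taylorConst d ξ / (H : ℝ) ^ d := by
  have hL := one_le_taylorConst d ξ
  set L := taylorConst d ξ with hLdef
  have hH0 : (0 : ℝ) < H := by exact_mod_cast hH
  let p : (Fin (d + 1) → Fin (H + 1)) → ℤ[X] := fun t ↦ ofFn (d + 1) fun i ↦ ((t i : ℕ) : ℤ)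
  have hpd : ∀ t, (p t).natDegree ≤ d := fun t ↦
    Nat.lt_succ_iff.mp (ofFn_natDegree_lt (by omega) _)
  have hpc : ∀ t i, 0 ≤ (p t).coeff i ∧ (p t).coeff i ≤ H := by
    intro t i
    by_cases hi : i < d + 1
    · rw [ofFn_coeff_eq_val_of_lt _ hi]
      have := (t ⟨i, hi⟩).is_lt
      omega
    · rw [ofFn_coeff_eq_zero_of_ge _ (by omega)]
      omega
  have hval : ∀ P : ℤ[X], P.natDegree ≤ d → P.supNorm ≤ H → |aeval ξ P| ≤ L * H := by
    intro P hP hPH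
    rw [← abs_taylor_coeff_zero]
    exact (abs_taylor_coeff_le hP ξ 0).trans (by gcongr)
  have hpH : ∀ t, (p t).supNorm ≤ H := fun t ↦ supNorm_le_of_forall fun i ↦ by
    rw [abs_of_nonneg (by exact_mod_cast (hpc t i).1)]
    exact_mod_cast (hpc t i).2
  let box : (Fin (d + 1) → Fin (H + 1)) → ℕ := fun t ↦
    ⌊(aeval ξ (p t) + L * H) * ((H : ℝ) ^ d / (2 * L))⌋₊
  have hnn : ∀ t, 0 ≤ (aeval ξ (p t) + L * H) * ((H : ℝ) ^ d / (2 * L)) := fun t ↦ by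
    have := abs_le.mp (hval _ (hpd t) (hpH t))
    exact mul_nonneg (by linarith) (by positivity)
  have hbox : ∀ t ∈ (Finset.univ : Finset (Fin (d + 1) → Fin (H + 1))),
      box t ∈ Finset.range (H ^ (d + 1) + 1) := by
    intro t _
    rw [Finset.mem_range, Nat.lt_succ_iff]
    refine Nat.floor_le_of_le ?_
    have := abs_le.mp (hval _ (hpd t) (hpH t))
    calc _ ≤ (2 * (L * H)) * ((H : ℝ) ^ d / (2 * L)) := by gcongr; linarith
      _ = _ := by push_cast; field_simp; ring
  have hcard : (Finset.range (H ^ (d + 1) + 1)).card <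
      (Finset.univ : Finset (Fin (d + 1) → Fin (H + 1))).card := by
    simp only [Finset.card_range, Finset.card_univ, Fintype.card_fun, Fintype.card_fin]
    have h1 : H ^ d < (H + 1) ^ d := Nat.pow_lt_pow_left (by omega) (by omega)
    have h2 : 1 ≤ H ^ d := Nat.one_le_pow _ _ hH
    rw [pow_succ, pow_succ]
    nlinarith
  obtain ⟨t, -, s, -, hts, hb⟩ := Finset.exists_ne_map_eq_of_card_lt_of_maps_to hcard hbox
  refine ⟨p t - p s, fun h ↦ hts ?_, (natDegree_sub_le _ _).trans (max_le (hpd t) (hpd s)), ?_, ?_⟩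
  · have hinj := congrArg (fun P : ℤ[X] ↦ fun i : Fin (d + 1) ↦ P.coeff i) (sub_eq_zero.mp h)
    ext i
    have := congrFun hinj i
    simp only [p, ofFn_coeff_eq_val_of_lt _ i.is_lt] at this
    exact_mod_cast this
  · refine supNorm_le_of_forall fun i ↦ ?_
    rw [coeff_sub]
    have h1 := hpc t i
    have h2 := hpc s i
    have : |(p t).coeff i - (p s).coeff i| ≤ H := abs_le.mpr ⟨by omega, by omega⟩
    exact_mod_cast this
  · have h1 := Nat.floor_le (hnn t)
    have h2 := Nat.lt_floor_add_one ((aeval ξ (p t) + L * H) * ((H : ℝ) ^ d / (2 * L)))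
    have h3 := Nat.floor_le (hnn s)
    have h4 := Nat.lt_floor_add_one ((aeval ξ (p s) + L * H) * ((H : ℝ) ^ d / (2 * L)))
    have hb' : (⌊(aeval ξ (p t) + L * H) * ((H : ℝ) ^ d / (2 * L))⌋₊ : ℝ) =
        ⌊(aeval ξ (p s) + L * H) * ((H : ℝ) ^ d / (2 * L))⌋₊ := congrArg Nat.cast hb
    have h5 : |(aeval ξ (p t) - aeval ξ (p s)) * ((H : ℝ) ^ d / (2 * L))| ≤ 1 :=
      abs_le.mpr ⟨by linarith, by linarith⟩
    rw [abs_mul, abs_of_pos (by positivity : 0 < (H : ℝ) ^ d / (2 * L)), ← map_sub] at h5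
    rw [le_div_iff₀ (by positivity)]
    rw [mul_div_assoc', div_le_one (by positivity)] at h5
    exact h5

lemma exists_forall_smallAt {d : ℕ} (hd : 1 ≤ d) {ξ v : ℝ} (hξ : Transcendental ℚ ξ)
    (hv : v < d) :
    ∃ X₀ : ℝ, ∀ X : ℝ, X₀ ≤ X → ∃ P : ℤ[X], P.natDegree ≤ d ∧ SmallAt ξ v X P := by
  refine eventually_atTop.mp ?_
  filter_upwards [eventually_ge_atTop 2,
    eventually_const_mul_rpow_lt (2 * taylorConst d ξ * 2 ^ d) (neg_lt_neg hv)] with Y hY hE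
  have hY0 : 0 < Y := by linarith
  have hL := one_le_taylorConst d ξ
  have hfl : Y / 2 ≤ (⌊Y⌋₊ : ℝ) := by linarith [Nat.lt_floor_add_one Y]
  obtain ⟨P, hP0, hPd, hPH, hPs⟩ := exists_small_of_pos hd ξ (H := ⌊Y⌋₊)
    (Nat.le_floor (by push_cast; linarith))
  refine ⟨P, hPd, hPH.trans (Nat.floor_le hY0.le),
    abs_pos.mpr (aeval_ne_zero_of_transcendental hξ hP0), hPs.trans ?_⟩
  calc _ ≤ 2 * taylorConst d ξ / (Y / 2) ^ d := by gcongr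
    _ = 2 * taylorConst d ξ * 2 ^ d * Y ^ (-(d : ℝ)) := by
        rw [Real.rpow_neg hY0.le, Real.rpow_natCast, div_pow]; field_simp
    _ ≤ _ := hE.le

/-! ### Exponents as suprema -/

lemma exists_mem_of_lt_supExp {S : Set ℝ} {w : ℝ} (h : (w : EReal) < supExp S) :
    ∃ w' ∈ S, w < w' := by
  rw [supExp, lt_iSup_iff] at h
  obtain ⟨w', h⟩ := h
  rw [lt_iSup_iff] at h
  obtain ⟨hw', h⟩ := h
  exact ⟨w', hw', EReal.coe_lt_coe_iff.mp h⟩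

lemma le_supExp {S : Set ℝ} {w : ℝ} (h : w ∈ S) : (w : EReal) ≤ supExp S :=
  le_iSup₂_of_le w h le_rfl

lemma le_of_forall_real_lt {a b : EReal} (h : ∀ w : ℝ, (w : EReal) < a → (w : EReal) ≤ b) :
    a ≤ b := by
  refine le_of_forall_lt fun c hc ↦ ?_
  obtain ⟨w, hcw, hwa⟩ := EReal.lt_iff_exists_real_btwn.mp hc
  exact hcw.trans_le (h w hwa)

lemma SmallAt.mono {ξ w v X : ℝ} {P : ℤ[X]} (hX : 1 ≤ X) (hvw : v ≤ w) (h : SmallAt ξ w X P) :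
    SmallAt ξ v X P :=
  ⟨h.1, h.2.1, h.2.2.trans (Real.rpow_le_rpow_of_exponent_le hX (by linarith))⟩

lemma infinite_of_lt_unitPolyExp {d : ℕ} {ξ w : ℝ} (h : (w : EReal) < unitPolyExp d ξ) :
    {P : ℤ[X] | IsUnitPoly d P ∧ ∃ X : ℝ, SmallAt ξ w X P}.Infinite := by
  obtain ⟨w', hw', hlt⟩ := exists_mem_of_lt_supExp h
  refine hw'.mono ?_
  rintro P ⟨hP, X, hX⟩
  exact ⟨hP, X, hX.mono ((one_le_supNorm hP.1.ne_zero).trans hX.1) hlt.le⟩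

lemma forall_of_lt_uniformExp {d : ℕ} {ξ w : ℝ} (h : (w : EReal) < uniformExp d ξ) :
    ∃ X₀ : ℝ, ∀ X : ℝ, X₀ ≤ X → ∃ P : ℤ[X], P.natDegree ≤ d ∧ SmallAt ξ w X P := by
  obtain ⟨w', ⟨X₀, hX₀⟩, hlt⟩ := exists_mem_of_lt_supExp h
  refine ⟨max X₀ 1, fun X hX ↦ ?_⟩
  obtain ⟨P, hP, hs⟩ := hX₀ X ((le_max_left _ _).trans hX)
  exact ⟨P, hP, hs.mono ((le_max_right _ _).trans hX) hlt.le⟩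

lemma le_uniformExp {d : ℕ} (hd : 1 ≤ d) {ξ : ℝ} (hξ : Transcendental ℚ ξ) :
    ((d : ℝ) : EReal) ≤ uniformExp d ξ :=
  le_of_forall_real_lt fun _ hv ↦
    le_supExp (exists_forall_smallAt hd hξ (EReal.coe_lt_coe_iff.mp hv))

lemma zero_le_unitPolyExp {n : ℕ} (hn : 2 ≤ n) (hn3 : n ≤ 3) {ξ : ℝ} (hξ : Transcendental ℚ ξ) :
    0 ≤ unitPolyExp n ξ :=
  le_of_forall_real_lt fun _ hv ↦
    le_supExp (infinite_unitPoly_of_neg hn hn3 hξ (by exact_mod_cast hv))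

theorem min_le_unitPolyExp {m n : ℕ} (hm : 1 ≤ m) (hmn : m ≤ n) (hn : 2 ≤ n) {ξ : ℝ}
    (hξ : Transcendental ℚ ξ)
    (h : ((2 * (n : ℝ) - 7 : ℝ) : EReal) < min (unitPolyExp m ξ) (uniformExp (n - 2) ξ)) :
    min (unitPolyExp m ξ) (uniformExp (n - 2) ξ) ≤ unitPolyExp n ξ := by
  refine le_of_forall_real_lt fun v hv ↦ ?_
  -- The pencil needs a positive exponent. A minimum at most 0 forces n ≤ 3, where the trinomials
  -- give exponent at least 0.
  by_cases h0 : ((0 : ℝ) : EReal) < min (unitPolyExp m ξ) (uniformExp (n - 2) ξ)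
  · obtain ⟨w, hlw, hw⟩ := EReal.lt_iff_exists_real_btwn.mp (max_lt hv (max_lt h0 h))
    rw [max_lt_iff, max_lt_iff, EReal.coe_lt_coe_iff, EReal.coe_lt_coe_iff,
      EReal.coe_lt_coe_iff] at hlw
    rw [lt_min_iff] at hw
    exact le_supExp (infinite_unitPoly hm hmn hn hξ hlw.2.1 hlw.2.2 hlw.1
      (infinite_of_lt_unitPolyExp hw.1) (forall_of_lt_uniformExp hw.2))
  · have h7 : 2 * (n : ℝ) - 7 < 0 := EReal.coe_lt_coe_iff.mp (h.trans_le (not_lt.mp h0))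
    have hn3 : n ≤ 3 := by
      have : 2 * n < 7 := by exact_mod_cast (by linarith : 2 * (n : ℝ) < 7)
      omega
    exact hv.le.trans ((not_lt.mp h0).trans (zero_le_unitPolyExp hn hn3 hξ))

/-- The derivative argument needs w > n - 2. Otherwise 2n - 7 < w ≤ n - 2 gives n ≤ 4, and the
target is below (n - 5)/2: below -1 for n ≤ 3 and below -1/2 for n = 4. -/
lemma le_unitRootExp_of_lt {m n : ℕ} (hm : 1 ≤ m) (hmn : m ≤ n) (hn : 2 ≤ n) {ξ v : ℝ}
    (hξ : Transcendental ℚ ξ)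
    (h : ((2 * (n : ℝ) - 7 : ℝ) : EReal) < min (unitPolyExp m ξ) (uniformExp (n - 2) ξ))
    (hv : (v : EReal) < min (unitPolyExp m ξ) (uniformExp (n - 2) ξ)) :
    ((3 / 2 * v - n + 1 / 2 : ℝ) : EReal) ≤ unitRootExp n ξ := by
  obtain ⟨w, hlw, hw⟩ := EReal.lt_iff_exists_real_btwn.mp (max_lt hv h)
  rw [max_lt_iff, EReal.coe_lt_coe_iff, EReal.coe_lt_coe_iff] at hlw
  rw [lt_min_iff] at hw
  obtain ⟨hvw, hnw⟩ := hlw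
  by_cases hwn : (n : ℝ) - 2 < w
  · refine le_trans ?_ (le_supExp (infinite_unitRoot hm hmn hn hξ hwn hnw
      (infinite_of_lt_unitPolyExp hw.1) (forall_of_lt_uniformExp hw.2)))
    rw [EReal.coe_le_coe_iff]
    linarith
  · have hn4 : n ≤ 4 := by
      have : n < 5 := by exact_mod_cast (by linarith : (n : ℝ) < 5)
      omega
    rcases (by omega : n ≤ 3 ∨ n = 4) with hn3 | rfl
    · refine le_supExp (infinite_unitRoot_of_lt_neg_one hn hn3 hξ ?_)
      have : (n : ℝ) ≤ 3 := by exact_mod_cast hn3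
      linarith
    · refine le_supExp (infinite_unitRoot_four hξ ?_)
      push_cast at hwn ⊢
      linarith

end ExactDegree

theorem theorem1p5 (m n : ℕ) (hm : 1 ≤ m) (hmn : m ≤ n) (hn : 2 ≤ n)
    (ξ : ℝ) (hξ : Transcendental ℚ ξ)
    (h : ((2 * (n : ℝ) - 7 : ℝ) : EReal) <
      min (ExactDegree.unitPolyExp m ξ) (ExactDegree.uniformExp (n - 2) ξ)) :
    min (ExactDegree.unitPolyExp m ξ) (ExactDegree.uniformExp (n - 2) ξ) ≤
        ExactDegree.unitPolyExp n ξ ∧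
      ((3 / 2 : ℝ) : EReal) *
            min (ExactDegree.unitPolyExp m ξ) (ExactDegree.uniformExp (n - 2) ξ) -
          ((n : ℝ) : EReal) + ((1 / 2 : ℝ) : EReal) ≤
        ExactDegree.unitRootExp n ξ ∧
      min (ExactDegree.unitPolyExp (n - 1) ξ) (((n : ℝ) - 2 : ℝ) : EReal) ≤
        ExactDegree.unitPolyExp n ξ := by
  have first := ExactDegree.min_le_unitPolyExp hm hmn hn hξ h
  refine ⟨first, ?_, ?_⟩
  · refine ExactDegree.le_of_forall_real_lt fun s hs ↦ ?_
    -- The preimage of s under v ↦ 3/2 v - n + 1/2.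
    have hv : (((s + n - 1 / 2) * (2 / 3) : ℝ) : EReal) <
        min (ExactDegree.unitPolyExp m ξ) (ExactDegree.uniformExp (n - 2) ξ) := by
      generalize min (ExactDegree.unitPolyExp m ξ) (ExactDegree.uniformExp (n - 2) ξ) = μ at h hs
      induction μ with
      | bot => exact absurd h not_lt_bot
      | top => exact EReal.coe_lt_top _
      | coe μ =>
        rw [← EReal.coe_mul, ← EReal.coe_sub, ← EReal.coe_add, EReal.coe_lt_coe_iff] at hs
        rw [EReal.coe_lt_coe_iff]
        linarith
    have := ExactDegree.le_unitRootExp_of_lt hm hmn hn hξ h hv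
    rwa [show 3 / 2 * ((s + n - 1 / 2) * (2 / 3)) - n + 1 / 2 = s by ring] at this
  -- For n = 2 the entry n - 2 is 0; for n ≥ 5 it is at most 2n - 7, already exceeded. For n = 3, 4
  -- Dirichlet's bound n - 2 exceeds 2n - 7, so the first claim applies with m = n - 1 unless the
  -- other entry is at most 2n - 7.
  · rcases (by omega : n = 2 ∨ (3 ≤ n ∧ n ≤ 4) ∨ 5 ≤ n) with rfl | ⟨hn3, hn4⟩ | hn5
    · refine (min_le_right _ _).trans ?_
      simpa using ExactDegree.zero_le_unitPolyExp le_rfl (by norm_num) hξ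
    · by_cases hc : ((2 * (n : ℝ) - 7 : ℝ) : EReal) < ExactDegree.unitPolyExp (n - 1) ξ
      · have hdir := ExactDegree.le_uniformExp (d := n - 2) (by omega) hξ
        rw [Nat.cast_sub hn, Nat.cast_ofNat] at hdir
        have hlt : ((2 * (n : ℝ) - 7 : ℝ) : EReal) < ((n : ℝ) - 2 : ℝ) := by
          have : (n : ℝ) ≤ 4 := by exact_mod_cast hn4
          exact EReal.coe_lt_coe_iff.mpr (by linarith)
        exact (min_le_min_left _ hdir).trans (ExactDegree.min_le_unitPolyExp (by omega)
          (Nat.sub_le n 1) hn hξ (lt_min hc (hlt.trans_le hdir)))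
      · exact (min_le_left _ _).trans ((not_lt.mp hc).trans (h.le.trans first))
    · refine (min_le_right _ _).trans (le_trans ?_ (h.le.trans first))
      have : (5 : ℝ) ≤ n := by exact_mod_cast hn5
      exact EReal.coe_le_coe_iff.mpr (by linarith)
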